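/- Let $\mathcal A$ be a finite central essential arrangement of hyperplanes in a finite-dimensional real vector space $W$ (so the hyperplanes are linear and intersect in $\{0\}$), with a chosen linear form $f_H$ defining each $H\in\mathcal A$, and let $R$ be a commutative ring. Let $L(\mathcal A)$ be the lattice of intersections of hyperplanes and $\mathcal F$ the set of faces, both ordered by reverse inclusion (of closures, for faces), and let $L_p(\mathcal A)$ be the set of $X\in L(\mathcal A)$ of codimension $p$. A face $F$ is determined by its sign sequence $(F_H)_{H\in\mathcal A}$; $\overline F$ is the opposite face, and $|F|$ is the smallest element of $L(\mathcal A)$, as a set, that contains $F$. The face product is given by $(FG)_H=F_H$ if $F_H\ne 0$ and $(FG)_H=G_H$ otherwise, and $A=R[\mathcal F]$ is the monoid algebra of the faces under this product. For $X\in L(\mathcal A)$ let $\mathcal A_X=\{H\in\mathcal A: X\subseteq H\}$, and let $\mathcal A^X$ be the restriction of $\mathcal A$ to $X$, whose chambers are the faces $F\in\mathcal F$ with $|F|=X$. Let $V(\mathcal A^X)$ be the free $R$-module on these chambers, made a left $A$-module by letting a face $F$ send a chamber $G$ to the face product $FG$ if $|F|\subseteq X$, and to $0$ otherwise. In particular $V(\mathcal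 A)=V(\mathcal A^W)$. Let $\mathrm{Fl}_p(\mathcal A_X)$ be the free $R$-module on the flags $\mathcal X=(X_0<X_1<\dots<X_p)$ in $L(\mathcal A_X)$ with $\operatorname{codim}X_i=i$, modulo the relations $$\sum_{Y:\,X_{i-1}<Y<X_{i+1}}(X_0<\dots<X_{i-1}<Y<X_{i+1}<\dots<X_p)=0\qquad(0<i<p).$$ For each hyperplane $H$ let $x_H$ be the function on chambers of $\mathcal A$ that is $1$ on the positive side of $H$ and $0$ otherwise. Let $W^pV(\mathcal A)$ be the set of all $v\in V(\mathcal A)$ with $f(v)=0$ for every $R$-linear functional $f$ on $V(\mathcal A)$ whose values on chambers are given by a polynomial over $R$ of degree at most $p-1$ in the functions $x_H$ (no condition if $p=0$). For a flag of faces $\mathfrak F=(F_0<\dots<F_p)$ with $\operatorname{codim}F_i=i$ put $|\mathfrak F|=(|F_0|<\dots<|F_p|)$ and $$b(\mathfrak F)=F_p(F_{p-1}-\overline{F_{p-1}})\cdots(F_0-\overline{F_0})\in V(\mathcal A)\subseteq A .$$ Choose an orientation of $W/X$ for each $X\in L(\mathcal A)$. For $F<G$ with $\operatorname{codim}G=\operatorname{codim}F+1$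 let $\varepsilon(F,G)=1$ if, for $w\in F$ and a positive volume form $\beta$ on $W/|G|$, the contraction $\beta(w,-,\dots,-)$ is the pullback of a positive volume form on $W/|F|$, and $\varepsilon(F,G)=-1$ otherwise. Put $\varepsilon(\mathfrak F)=\prod_{i=0}^{p-1}\varepsilon(F_i,F_{i+1})$. Then $W^pV(\mathcal A)$ is an $A$-submodule of $V(\mathcal A)$. For all $X\in L_p(\mathcal A)$, all flags $\mathcal X=(X_0<\dots<X_p)$ in $L(\mathcal A_X)$ as above and all chambers $C$ of $\mathcal A^X$ there is a flag of faces $\mathfrak F$ with $|\mathfrak F|=\mathcal X$ and $F_p=C$. There is a unique $R$-linear map $$\phi_p:\bigoplus_{X\in L_p(\mathcal A)}\mathrm{Fl}_p(\mathcal A_X)\otimes_R V(\mathcal A^X)\longrightarrow W^pV(\mathcal A)$$ such that $\phi_p(\mathcal X\otimes C)=\varepsilon(\mathfrak F)\,b(\mathfrak F)$ for all such $X$, $\mathcal X$, $C$ and every flag of faces $\mathfrak F$ with $|\mathfrak F|=\mathcal X$ and $F_p=C$. This map $\phi_p$ is a homomorphism of left $A$-modules, where $A$ acts on the source through the factors $V(\mathcal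 A^X)$. -/

import Mathlib

open scoped TensorProduct DirectSum

/-- A finite central essential arrangement of hyperplanes in a real vector space `W`, indexed by
`ι`, with a choice of a linear form `f_H` for each hyperplane `H`; the positive side of `H` is
`{f_H > 0}`. -/
structure HypArrangement (ι W : Type*) [AddCommGroup W] [Module ℝ W] where
  form : ι → Module.Dual ℝ W
  form_ne_zero : ∀ i, form i ≠ 0
  ker_injective : Function.Injective fun i => LinearMap.ker (form i)
  essential : ⨅ i, LinearMap.ker (form i) = ⊥

namespace HypArrangement

section Geometry

variable {ι W : Type*} [AddCommGroup W] [Module ℝ W]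

/-- The hyperplane with index `i`. -/
def hyp (𝒜 : HypArrangement ι W) (i : ι) : Submodule ℝ W := LinearMap.ker (𝒜.form i)

/-- An element of the intersection lattice `L(𝒜)`: an intersection of some of the hyperplanes
(the empty intersection being `W`). -/
@[ext]
structure Flat (𝒜 : HypArrangement ι W) where
  carrier : Submodule ℝ W
  isInter : ∃ S : Set ι, carrier = ⨅ i ∈ S, 𝒜.hyp i

/-- `L(𝒜)` is ordered by reverse inclusion. -/
instance (𝒜 : HypArrangement ι W) : PartialOrder 𝒜.Flat where
  le X Y := Y.carrier ≤ X.carrier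
  le_refl X := le_refl X.carrier
  le_trans _ _ _ h h' := le_trans h' h
  le_antisymm _ _ h h' := Flat.ext (le_antisymm h' h)

/-- The subspaces in the intersection lattice of the localization `𝒜_X = {H ∈ 𝒜 : X ⊆ H}` are the
elements of `L(𝒜)` that are at most `X`. -/
theorem isInter_localization_iff (𝒜 : HypArrangement ι W) (X : 𝒜.Flat) (U : Submodule ℝ W) :
    (∃ S : Set ι, S ⊆ {i | X.carrier ≤ 𝒜.hyp i} ∧ U = ⨅ i ∈ S, 𝒜.hyp i) ↔
      ∃ Y : 𝒜.Flat, Y ≤ X ∧ Y.carrier = U := by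
  constructor
  · rintro ⟨S, hS, rfl⟩
    refine ⟨⟨_, S, rfl⟩, ?_, rfl⟩
    change X.carrier ≤ ⨅ i ∈ S, 𝒜.hyp i
    exact le_iInf₂ fun i hi => hS hi
  · rintro ⟨⟨_, S, rfl⟩, hY, rfl⟩
    change X.carrier ≤ ⨅ i ∈ S, 𝒜.hyp i at hY
    exact ⟨S, fun i hi => hY.trans (iInf₂_le i hi), rfl⟩

/-- The codimension of an element of `L(𝒜)`, i.e. its rank in `L(𝒜)`. -/
noncomputable def Flat.codim {𝒜 : HypArrangement ι W} (X : 𝒜.Flat) : ℕ :=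
  Module.finrank ℝ (W ⧸ X.carrier)

/-- The whole space `W`, the least element of `L(𝒜)`. -/
def wholeFlat (𝒜 : HypArrangement ι W) : 𝒜.Flat := ⟨⊤, ∅, by simp⟩

/-- `L_p(𝒜)`, the set of elements of `L(𝒜)` of codimension `p`. -/
abbrev L (𝒜 : HypArrangement ι W) (p : ℕ) : Type _ := {X : 𝒜.Flat // X.codim = p}

instance (𝒜 : HypArrangement ι W) [Finite ι] : Finite 𝒜.Flat := by
  refine Finite.of_injective (fun X : 𝒜.Flat => (X.isInter).choose) fun X Y h => ?_
  ext1
  rw [X.isInter.choose_spec, Y.isInter.choose_spec]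
  exact congrArg (fun S : Set ι => ⨅ i ∈ S, 𝒜.hyp i) h

/-- A face of `𝒜`, given by its sign sequence `(F_H)`: the set of points of `W` whose sequence of
signs `sign (f_H w)` is the given one is required to be non-empty. -/
@[ext]
structure Face (𝒜 : HypArrangement ι W) where
  sgn : ι → SignType
  realized : ∃ w : W, ∀ i, SignType.sign (𝒜.form i w) = sgn i

namespace Face

variable {𝒜 : HypArrangement ι W}

/-- The points of a face. -/
def points (F : 𝒜.Face) : Set W := {w | ∀ i, SignType.sign (𝒜.form i w) = F.sgn i}

/-- Faces are ordered by reverse inclusion of their closures. In terms of sign sequences, the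
closure of `F` contains `G` if and only if `G` arises from `F` by replacing some signs by `0`. -/
instance : PartialOrder 𝒜.Face where
  le F G := ∀ i, G.sgn i = 0 ∨ G.sgn i = F.sgn i
  le_refl _ _ := Or.inr rfl
  le_trans F G K h h' i := by
    rcases h' i with h1 | h1
    · exact Or.inl h1
    · rw [h1]; exact h i
  le_antisymm F G h h' := by
    ext i : 2
    rcases h i with h1 | h1
    · rcases h' i with h2 | h2
      · rw [h1, h2]
      · exact h2
    · exact h1.symm

/-- The subspace `|F|`, the intersection of the hyperplanes that contain `F`. -/
def support (F : 𝒜.Face) : 𝒜.Flat := ⟨⨅ i ∈ {i | F.sgn i = 0}, 𝒜.hyp i, _, rfl⟩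

theorem points_subset_hyp_iff (F : 𝒜.Face) (i : ι) :
    F.points ⊆ 𝒜.hyp i ↔ F.sgn i = 0 := by
  constructor
  · intro h
    obtain ⟨w, hw⟩ := F.realized
    have h0 : 𝒜.form i w = 0 := h (show w ∈ F.points from hw)
    rw [← hw i, h0, sign_zero]
  · intro h w hw
    have := hw i
    rw [h, sign_eq_zero_iff] at this
    exact this

/-- `|F|` is the smallest subspace in `L(𝒜)` that contains `F`. -/
theorem support_isLeast (F : 𝒜.Face) (Y : 𝒜.Flat) :
    F.points ⊆ Y.carrier ↔ F.support.carrier ≤ Y.carrier := by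
  constructor
  · intro h
    obtain ⟨S, hS⟩ := Y.isInter
    rw [hS]
    refine le_iInf₂ fun i hi => iInf₂_le i ((F.points_subset_hyp_iff i).1 fun w hw => ?_)
    have := h hw
    rw [hS] at this
    exact (iInf₂_le (f := fun i (_ : i ∈ S) => 𝒜.hyp i) i hi) this
  · intro h w hw
    refine h ?_
    simp only [support, Submodule.mem_iInf]
    exact fun i hi => (F.points_subset_hyp_iff i).2 hi hw

/-- A face with support `X` vanishes exactly on the hyperplanes that contain `X`. -/
theorem sgn_eq_zero_iff (F : 𝒜.Face) (i : ι) : F.sgn i = 0 ↔ F.support.carrier ≤ 𝒜.hyp i := by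
  rw [← F.points_subset_hyp_iff i]
  exact F.support_isLeast ⟨𝒜.hyp i, {i}, by simp⟩

theorem support_eq_of_sgn {F G : 𝒜.Face} (h : ∀ i, F.sgn i = 0 ↔ G.sgn i = 0) :
    F.support = G.support := by
  ext1
  have : {i | F.sgn i = 0} = {i | G.sgn i = 0} := Set.ext h
  simp only [support, this]

/-- The codimension of a face. -/
noncomputable def codim (F : 𝒜.Face) : ℕ := F.support.codim

/-- The opposite face `-F`. -/
def opp (F : 𝒜.Face) : 𝒜.Face where
  sgn i := - F.sgn i
  realized := by
    obtain ⟨w, hw⟩ := F.realized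
    exact ⟨-w, fun i => by rw [map_neg, Left.sign_neg, hw i]⟩

/-- The product of sign sequences of faces is the sign sequence of a face. -/
theorem mul_realized [Finite ι] (F G : 𝒜.Face) :
    ∃ w : W, ∀ i, SignType.sign (𝒜.form i w) = if F.sgn i ≠ 0 then F.sgn i else G.sgn i := by
  obtain ⟨w, hw⟩ := F.realized
  obtain ⟨v, hv⟩ := G.realized
  have key : ∀ᶠ ε : ℝ in nhdsWithin 0 (Set.Ioi 0), ∀ i,
      SignType.sign (𝒜.form i (w + ε • v)) = if F.sgn i ≠ 0 then F.sgn i else G.sgn i := by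
    rw [Filter.eventually_all]
    intro i
    have hlim : Filter.Tendsto (fun ε : ℝ => 𝒜.form i w + ε * 𝒜.form i v)
        (nhdsWithin 0 (Set.Ioi 0)) (nhds (𝒜.form i w)) := by
      have : Filter.Tendsto (fun ε : ℝ => 𝒜.form i w + ε * 𝒜.form i v) (nhds 0)
          (nhds (𝒜.form i w + 0 * 𝒜.form i v)) := by
        apply Continuous.tendsto
        fun_prop
      rw [zero_mul, add_zero] at this
      exact this.mono_left nhdsWithin_le_nhds
    rcases lt_trichotomy (𝒜.form i w) 0 with h | h | h
    · filter_upwards [hlim.eventually_lt_const h] with ε hε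
      have h1 : F.sgn i = -1 := by rw [← hw i, sign_neg h]
      simp [h1, sign_neg hε]
    · filter_upwards [self_mem_nhdsWithin] with ε hε
      have h1 : F.sgn i = 0 := by rw [← hw i, h, sign_zero]
      have h2 : SignType.sign ε = 1 := sign_pos hε
      simp [h1, h, sign_mul, h2, hv i]
    · filter_upwards [hlim.eventually_const_lt h] with ε hε
      have h1 : F.sgn i = 1 := by rw [← hw i, sign_pos h]
      simp [h1, sign_pos hε]
  obtain ⟨ε, hε⟩ := key.exists
  exact ⟨_, hε⟩

/-- The face product. Its identity element is the face `{0}`. -/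
instance [Finite ι] : Monoid 𝒜.Face where
  mul F G := ⟨fun i => if F.sgn i ≠ 0 then F.sgn i else G.sgn i, mul_realized F G⟩
  one := ⟨fun _ => 0, 0, fun i => by rw [map_zero, sign_zero]⟩
  mul_assoc F G K := by
    refine Face.ext (funext fun i => ?_)
    change (if (if F.sgn i ≠ 0 then F.sgn i else G.sgn i) ≠ 0 then
        (if F.sgn i ≠ 0 then F.sgn i else G.sgn i) else K.sgn i) =
      if F.sgn i ≠ 0 then F.sgn i else (if G.sgn i ≠ 0 then G.sgn i else K.sgn i)
    by_cases h : F.sgn i = 0 <;> simp [h]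
  one_mul F := by
    refine Face.ext (funext fun i => ?_)
    change (if (0 : SignType) ≠ 0 then (0 : SignType) else F.sgn i) = F.sgn i
    simp
  mul_one F := by
    refine Face.ext (funext fun i => ?_)
    change (if F.sgn i ≠ 0 then F.sgn i else (0 : SignType)) = F.sgn i
    by_cases h : F.sgn i = 0 <;> simp [h]

theorem mul_sgn [Finite ι] (F G : 𝒜.Face) (i : ι) :
    (F * G).sgn i = if F.sgn i ≠ 0 then F.sgn i else G.sgn i := rfl

theorem one_sgn [Finite ι] (i : ι) : (1 : 𝒜.Face).sgn i = 0 := rfl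

theorem le_support_iff (F : 𝒜.Face) (X : 𝒜.Flat) :
    X ≤ F.support ↔ ∀ i, X.carrier ≤ 𝒜.hyp i → F.sgn i = 0 := by
  constructor
  · intro h i hi
    rw [sgn_eq_zero_iff]
    exact le_trans h hi
  · intro h
    obtain ⟨S, hS⟩ := X.isInter
    change F.support.carrier ≤ X.carrier
    rw [hS]
    refine le_iInf₂ fun i hi => (F.sgn_eq_zero_iff i).1 (h i ?_)
    rw [hS]
    exact iInf₂_le i hi

theorem le_support_mul_iff [Finite ι] (F G : 𝒜.Face) (X : 𝒜.Flat) :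
    X ≤ (F * G).support ↔ X ≤ F.support ∧ X ≤ G.support := by
  simp only [le_support_iff, mul_sgn]
  constructor
  · intro h
    refine ⟨fun i hi => ?_, fun i hi => ?_⟩ <;> have := h i hi <;>
      by_cases h0 : F.sgn i = 0 <;> simp_all
  · rintro ⟨h1, h2⟩ i hi
    simp [h1 i hi, h2 i hi]

theorem le_support_one [Finite ι] (X : 𝒜.Flat) : X ≤ (1 : 𝒜.Face).support := by
  rw [le_support_iff]
  exact fun i _ => one_sgn i

theorem support_mul [Finite ι] (F G : 𝒜.Face) (h : G.support ≤ F.support) :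
    (F * G).support = G.support := by
  refine support_eq_of_sgn fun i => ?_
  rw [mul_sgn]
  have := (le_support_iff F G.support).1 h i
  rw [← G.sgn_eq_zero_iff i] at this
  by_cases h0 : F.sgn i = 0 <;> simp_all

end Face

/-- The faces of codimension `p`. -/
abbrev FaceOfCodim (𝒜 : HypArrangement ι W) (p : ℕ) : Type _ := {F : 𝒜.Face // F.codim = p}

/-- The chambers of the restriction `𝒜^X`, identified with the faces `F` of `𝒜` with `|F| = X`.
For `X = W` these are the chambers of `𝒜`. -/
abbrev Chamber (𝒜 : HypArrangement ι W) (X : 𝒜.Flat) : Type _ := {F : 𝒜.Face // F.support = X}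

/-- The elements of `flag_p(L(𝒜_X))`: chains `X_0 < X_1 < ⋯ < X_p` in `L(𝒜_X)`, where `X_i` has
rank (that is, codimension) `i`. -/
@[ext]
structure LocalFlag (𝒜 : HypArrangement ι W) (p : ℕ) (X : 𝒜.Flat) where
  flat : Fin (p + 1) → 𝒜.Flat
  strictMono : StrictMono flat
  codim_eq : ∀ i, (flat i).codim = i
  le : ∀ i, flat i ≤ X

instance (𝒜 : HypArrangement ι W) [Finite ι] (p : ℕ) (X : 𝒜.Flat) :
    Finite (𝒜.LocalFlag p X) :=
  Finite.of_injective LocalFlag.flat fun _ _ => LocalFlag.ext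

noncomputable instance (𝒜 : HypArrangement ι W) [Finite ι] (p : ℕ) (X : 𝒜.Flat) :
    Fintype (𝒜.LocalFlag p X) := Fintype.ofFinite _

/-- The elements of `flag_p(ℱ(𝒜))`: chains of faces `F_0 < F_1 < ⋯ < F_p`, where `F_i` has
codimension `i`. -/
@[ext]
structure FaceFlag (𝒜 : HypArrangement ι W) (p : ℕ) where
  face : Fin (p + 1) → 𝒜.Face
  strictMono : StrictMono face
  codim_eq : ∀ i, (face i).codim = i

/-- A choice of a coorientation of each element `X` of `L(𝒜)`, that is, of an orientation of
`W ⧸ X`. The affine span of the face of the zonotope that belongs to a face `F` of `𝒜` is parallel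
to the dual space `(W ⧸ X)^*` of `W ⧸ X`, where `X = |F|`; so this is the same as a choice of an
orientation of each face of the zonotope, such that parallel faces have the same orientation. -/
abbrev Coorientation (𝒜 : HypArrangement ι W) : Type _ :=
  ∀ (p : ℕ) (X : 𝒜.L p), Orientation ℝ (W ⧸ X.1.carrier) (Fin p)

/-- For a covering relation `F < G`, with `X = |F|` and `Y = |G|`: the orientations at `F` and `G`
agree if the contraction `β(w, -, …, -)` of a positive volume form `β` of `W ⧸ Y` with a vector
`w ∈ F` is (the pullback of) a positive volume form `α` of `W ⧸ X`. For the zonotope this says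
that an outward normal, followed by a positive basis of the facet of `F`, is a positive basis of
the face of `G`. -/
def OrientationsAgree {𝒜 : HypArrangement ι W} (o : 𝒜.Coorientation) {k : ℕ}
    (F : 𝒜.FaceOfCodim k) (G : 𝒜.FaceOfCodim (k + 1)) : Prop :=
  ∃ w ∈ F.1.points,
    ∃ (α : (W ⧸ F.1.support.carrier) [⋀^Fin k]→ₗ[ℝ] ℝ)
      (β : (W ⧸ G.1.support.carrier) [⋀^Fin (k + 1)]→ₗ[ℝ] ℝ)
      (hα : α ≠ 0) (hβ : β ≠ 0),
      rayOfNeZero ℝ α hα = o k ⟨F.1.support, F.2⟩ ∧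
      rayOfNeZero ℝ β hβ = o (k + 1) ⟨G.1.support, G.2⟩ ∧
      ∀ u : Fin k → W,
        β (Fin.cons (G.1.support.carrier.mkQ w) fun j => G.1.support.carrier.mkQ (u j)) =
          α fun j => F.1.support.carrier.mkQ (u j)

open Classical in
/-- The sign `ε(F, G)` of a covering relation `F < G`. -/
noncomputable def eps {𝒜 : HypArrangement ι W} (o : 𝒜.Coorientation) {k : ℕ}
    (F : 𝒜.FaceOfCodim k) (G : 𝒜.FaceOfCodim (k + 1)) : ℤ :=
  if OrientationsAgree o F G then 1 else -1

/-- The sign `ε(𝔉) = ∏_{i < p} ε(F_i, F_{i+1})` of a flag of faces. -/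
noncomputable def FaceFlag.sign {𝒜 : HypArrangement ι W} (o : 𝒜.Coorientation) {p : ℕ}
    (𝔉 : 𝒜.FaceFlag p) : ℤ :=
  ∏ i : Fin p, eps o (k := i) ⟨𝔉.face i.castSucc, 𝔉.codim_eq i.castSucc⟩
    ⟨𝔉.face i.succ, 𝔉.codim_eq i.succ⟩

end Geometry

section Algebra

variable (R : Type*) [CommRing R] {ι W : Type*} [Finite ι] [AddCommGroup W] [Module ℝ W]
  (𝒜 : HypArrangement ι W)

/-- The face algebra `R[ℱ]`. -/
abbrev FaceAlgebra : Type _ := MonoidAlgebra R 𝒜.Face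

/-- `V(𝒜^X)`, the free `R`-module on the chambers of `𝒜^X`. -/
def V (X : 𝒜.Flat) : Type _ := 𝒜.Chamber X →₀ R

noncomputable instance (X : 𝒜.Flat) : AddCommGroup (𝒜.V R X) :=
  inferInstanceAs (AddCommGroup (𝒜.Chamber X →₀ R))

noncomputable instance (X : 𝒜.Flat) : Module R (𝒜.V R X) :=
  inferInstanceAs (Module R (𝒜.Chamber X →₀ R))

/-- The basis element of `V(𝒜^X)` given by a chamber of `𝒜^X`. -/
noncomputable def V.of {X : 𝒜.Flat} (C : 𝒜.Chamber X) : 𝒜.V R X := Finsupp.single C 1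

/-- The basis of `V(𝒜^X)` given by the chambers of `𝒜^X`. -/
noncomputable def V.basis (X : 𝒜.Flat) : Module.Basis (𝒜.Chamber X) R (𝒜.V R X) :=
  Module.Basis.ofRepr (LinearEquiv.refl R (𝒜.Chamber X →₀ R))

set_option linter.unusedSectionVars false in
theorem V.basis_apply {X : 𝒜.Flat} (C : 𝒜.Chamber X) : V.basis R 𝒜 X C = V.of R 𝒜 C := rfl

open Classical in
/-- The action of a face `F` on a chamber `G` of `𝒜^X`: it is `FG` if `|F| ≥ X`, and `0`
otherwise. -/
noncomputable def faceActOn {X : 𝒜.Flat} (F : 𝒜.Face) (G : 𝒜.Chamber X) : 𝒜.V R X :=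
  if h : X ≤ F.support then
    V.of R 𝒜 ⟨F * G.1, (Face.support_mul F G.1 (G.2.symm ▸ h)).trans G.2⟩
  else 0

/-- The action of the monoid of faces on `V(𝒜^X)`. -/
noncomputable def faceAct (X : 𝒜.Flat) : 𝒜.Face →* Module.End R (𝒜.V R X) where
  toFun F := (V.basis R 𝒜 X).constr R (faceActOn R 𝒜 F)
  map_one' := by
    refine (V.basis R 𝒜 X).ext fun G => ?_
    rw [Module.Basis.constr_basis, faceActOn, dif_pos (Face.le_support_one X)]
    simp [V.basis_apply]
  map_mul' F F' := by
    refine (V.basis R 𝒜 X).ext fun G => ?_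
    rw [Module.End.mul_apply, Module.Basis.constr_basis, Module.Basis.constr_basis]
    by_cases h' : X ≤ F'.support
    · rw [faceActOn.eq_1 R 𝒜 F', dif_pos h', ← V.basis_apply, Module.Basis.constr_basis]
      by_cases h : X ≤ F.support
      · rw [faceActOn, dif_pos ((Face.le_support_mul_iff F F' X).2 ⟨h, h'⟩), faceActOn,
          dif_pos h]
        simp [mul_assoc]
      · rw [faceActOn, dif_neg (fun h0 => h ((Face.le_support_mul_iff F F' X).1 h0).1), faceActOn,
          dif_neg h]
    · rw [faceActOn, dif_neg (fun h0 => h' ((Face.le_support_mul_iff F F' X).1 h0).2),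
        faceActOn, dif_neg h', map_zero]

theorem faceAct_of {X : 𝒜.Flat} (F : 𝒜.Face) (G : 𝒜.Chamber X) :
    faceAct R 𝒜 X F (V.of R 𝒜 G) = faceActOn R 𝒜 F G :=
  (V.basis R 𝒜 X).constr_basis R _ G

/-- The action of the face algebra on `V(𝒜^X)`, which extends the action of faces linearly. -/
noncomputable def algAct (X : 𝒜.Flat) : 𝒜.FaceAlgebra R →ₐ[R] Module.End R (𝒜.V R X) :=
  MonoidAlgebra.lift R _ 𝒜.Face (faceAct R 𝒜 X)

/-- `V(𝒜^X)` as a left module over the face algebra. -/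
noncomputable instance (X : 𝒜.Flat) : Module (𝒜.FaceAlgebra R) (𝒜.V R X) :=
  Module.compHom _ (algAct R 𝒜 X).toRingHom

theorem algebra_smul_def {X : 𝒜.Flat} (a : 𝒜.FaceAlgebra R) (v : 𝒜.V R X) :
    a • v = algAct R 𝒜 X a v := rfl

/-- The `i`-th relation given by a flag `(X_0 < ⋯ < X_p)`, with `0 < i < p`: the sum of all flags
`(X_0 < ⋯ < X_{i-1} < Y < X_{i+1} < ⋯ < X_p)` with `X_{i-1} < Y < X_{i+1}`. These are exactly the
flags that coincide with the given one away from position `i`. -/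
noncomputable def flagRelation {p : ℕ} {X : 𝒜.Flat} (𝒳 : 𝒜.LocalFlag p X) (i : Fin (p + 1)) :
    𝒜.LocalFlag p X →₀ R :=
  open Classical in
  ∑ 𝒴 : 𝒜.LocalFlag p X with ∀ j, j ≠ i → 𝒴.flat j = 𝒳.flat j, Finsupp.single 𝒴 1

/-- The span of the relations in the free module on the `p`-flags of `L(𝒜_X)`. -/
noncomputable def flagRelations (p : ℕ) (X : 𝒜.Flat) : Submodule R (𝒜.LocalFlag p X →₀ R) :=
  Submodule.span R {r | ∃ (𝒳 : 𝒜.LocalFlag p X) (i : Fin (p + 1)),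
    0 < (i : ℕ) ∧ (i : ℕ) < p ∧ r = flagRelation R 𝒜 𝒳 i}

/-- `Fl_p(𝒜_X)` with coefficients in `R`: the free `R`-module on the `p`-flags of `L(𝒜_X)`, modulo
the relations. For `R = ℤ` this is the group `Fl_p(𝒜_X)` itself, and in general it is the extension
of scalars of that group to `R`. -/
abbrev Fl (p : ℕ) (X : 𝒜.Flat) : Type _ := (𝒜.LocalFlag p X →₀ R) ⧸ flagRelations R 𝒜 p X

/-- The class of a flag in `Fl_p(𝒜_X)`. -/
noncomputable def Fl.of {p : ℕ} {X : 𝒜.Flat} (𝒳 : 𝒜.LocalFlag p X) : 𝒜.Fl R p X :=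
  (flagRelations R 𝒜 p X).mkQ (Finsupp.single 𝒳 1)

/-- `Fl_p(𝒜_X) ⊗ V(𝒜^X)`. -/
def FlV (p : ℕ) (X : 𝒜.Flat) : Type _ := 𝒜.Fl R p X ⊗[R] 𝒜.V R X

noncomputable instance (p : ℕ) (X : 𝒜.Flat) : AddCommGroup (𝒜.FlV R p X) :=
  inferInstanceAs (AddCommGroup (𝒜.Fl R p X ⊗[R] 𝒜.V R X))

noncomputable instance (p : ℕ) (X : 𝒜.Flat) : Module R (𝒜.FlV R p X) :=
  inferInstanceAs (Module R (𝒜.Fl R p X ⊗[R] 𝒜.V R X))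

/-- The face algebra acts on `Fl_p(𝒜_X) ⊗ V(𝒜^X)` through the second factor. -/
noncomputable instance (p : ℕ) (X : 𝒜.Flat) : Module (𝒜.FaceAlgebra R) (𝒜.FlV R p X) :=
  Module.compHom (𝒜.Fl R p X ⊗[R] 𝒜.V R X)
    ((Module.End.lTensorAlgHom R (𝒜.V R X) (𝒜.Fl R p X)).comp (algAct R 𝒜 X)).toRingHom

/-- The element `ξ ⊗ v` of `Fl_p(𝒜_X) ⊗ V(𝒜^X)`. -/
noncomputable def FlV.tmul {p : ℕ} {X : 𝒜.Flat} (ξ : 𝒜.Fl R p X) (v : 𝒜.V R X) : 𝒜.FlV R p X := ξ ⊗ₜ[R] v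

theorem FlV.smul_tmul {p : ℕ} {X : 𝒜.Flat} (a : 𝒜.FaceAlgebra R) (ξ : 𝒜.Fl R p X)
    (v : 𝒜.V R X) : a • FlV.tmul R 𝒜 ξ v = FlV.tmul R 𝒜 ξ (a • v) := rfl

/-- The module `⨁_{X ∈ L_p(𝒜)} Fl_p(𝒜_X) ⊗ V(𝒜^X)`; it carries the structures of an `R`-module and
of a left module over the face algebra. -/
abbrev Source (p : ℕ) : Type _ := ⨁ X : 𝒜.L p, 𝒜.FlV R p X.1

/-- `V(𝒜)`, the free `R`-module on the chambers of `𝒜`; here `𝒜 = 𝒜^W`. -/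
abbrev VA : Type _ := 𝒜.V R 𝒜.wholeFlat

/-- The value of the Heaviside function `x_H` at a chamber: `1` on the positive side of `H`, and
`0` otherwise. -/
def heaviside (C : 𝒜.Chamber 𝒜.wholeFlat) (i : ι) : R := if C.1.sgn i = 1 then 1 else 0

/-- `P_d V^*`: the functions on chambers (linear forms on `V`) that can be written as a polynomial
of degree at most `d` in the functions `x_H`, for the coordinatewise multiplication. -/
def degreeLE (d : ℕ) : Set (Module.Dual R (𝒜.VA R)) :=
  {f | ∃ q : MvPolynomial ι R, q.totalDegree ≤ d ∧
    ∀ C, f (V.of R 𝒜 C) = MvPolynomial.eval (heaviside R 𝒜 C) q}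

/-- `P_d V^*` is stable under the transpose of the action of a face. -/
theorem degreeLE_comp_faceAct {d : ℕ} {f : Module.Dual R (𝒜.VA R)} (hf : f ∈ degreeLE R 𝒜 d)
    (F : 𝒜.Face) : f ∘ₗ faceAct R 𝒜 𝒜.wholeFlat F ∈ degreeLE R 𝒜 d := by
  classical
  obtain ⟨q, hq, hf⟩ := hf
  let s : ι → MvPolynomial ι R := fun i =>
    if F.sgn i = 0 then MvPolynomial.X i else MvPolynomial.C (if F.sgn i = 1 then 1 else 0)
  have hs : ∀ i, (s i).totalDegree ≤ 1 := by
    intro i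
    by_cases h : F.sgn i = 0
    · simp only [s, h, if_true]
      exact (MvPolynomial.totalDegree_monomial_le _ _).trans (by simp)
    · simp only [s, h, if_false, MvPolynomial.totalDegree_C]
      exact Nat.zero_le 1
  refine ⟨MvPolynomial.aeval s q, ?_, fun C => ?_⟩
  · rw [MvPolynomial.aeval_def, MvPolynomial.eval₂_eq]
    refine MvPolynomial.totalDegree_finsetSum_le fun m hm => ?_
    rw [← Algebra.smul_def]
    refine (MvPolynomial.totalDegree_smul_le _ _).trans ?_
    refine (MvPolynomial.totalDegree_finsetProd _ _).trans ?_
    refine le_trans (Finset.sum_le_sum fun i _ => ?_) ((MvPolynomial.le_totalDegree hm).trans hq)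
    refine (MvPolynomial.totalDegree_pow _ _).trans ?_
    exact (Nat.mul_le_mul_left _ (hs i)).trans (by simp)
  · have hle : 𝒜.wholeFlat ≤ F.support := le_top (α := Submodule ℝ W)
    rw [LinearMap.comp_apply, faceAct_of, faceActOn, dif_pos hle, hf, ← MvPolynomial.coe_aeval_eq_eval,
      ← MvPolynomial.coe_aeval_eq_eval]
    change _ = ((MvPolynomial.aeval (heaviside R 𝒜 C)).comp (MvPolynomial.aeval s)) q
    rw [MvPolynomial.comp_aeval]
    change MvPolynomial.aeval _ q = _
    congr 2
    funext i
    by_cases h : F.sgn i = 0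
    · simp [s, h, heaviside, Face.mul_sgn]
    · simp only [s, h, heaviside, Face.mul_sgn]
      by_cases h1 : F.sgn i = 1 <;> simp [h, h1]

/-- The dual filtration `W^p V(𝒜)`: the elements of `V(𝒜)` at which all functions in
`P_{p-1} V^*` vanish (where `P_{-1} V^* = 0`). It is a submodule over the face algebra. -/
noncomputable def filtW (p : ℕ) : Submodule (𝒜.FaceAlgebra R) (𝒜.VA R) where
  carrier := {v | ∀ d, d + 1 = p → ∀ f ∈ degreeLE R 𝒜 d, f v = 0}
  add_mem' hv hw d hd f hf := by rw [map_add, hv d hd f hf, hw d hd f hf, add_zero]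
  zero_mem' d hd f hf := map_zero f
  smul_mem' a v hv := by
    intro d hd f hf
    induction a using MonoidAlgebra.induction_linear with
    | zero => rw [zero_smul, map_zero]
    | add a b ha hb => rw [add_smul, map_add, ha, hb, add_zero]
    | single F r =>
      rw [algebra_smul_def, algAct, MonoidAlgebra.lift_single, LinearMap.smul_apply, map_smul]
      have := hv d hd _ (degreeLE_comp_faceAct R 𝒜 hf F)
      rw [LinearMap.comp_apply] at this
      rw [this, smul_zero]

/-- The inclusion of `V(𝒜)` in the face algebra, which sends a chamber to itself. -/
noncomputable def chamberIncl : 𝒜.VA R →ₗ[R] 𝒜.FaceAlgebra R :=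
  (V.basis R 𝒜 𝒜.wholeFlat).constr R fun C => MonoidAlgebra.of R 𝒜.Face C.1

/-- The product `(F_{p-1} - \overline{F_{p-1}}) ⋯ (F_1 - \overline{F_1}) (F_0 - \overline{F_0})` in
the face algebra. -/
noncomputable def diffProd : (p : ℕ) → (Fin p → 𝒜.Face) → 𝒜.FaceAlgebra R
  | 0, _ => 1
  | p + 1, F =>
    (MonoidAlgebra.of R 𝒜.Face (F (Fin.last p)) -
      MonoidAlgebra.of R 𝒜.Face (F (Fin.last p)).opp) * diffProd p fun i => F i.castSucc

/-- The flag cochain `b(𝔉) = F_p (F_{p-1} - \overline{F_{p-1}}) ⋯ (F_0 - \overline{F_0})`, as an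
element of the face algebra. Since `F_0` is a chamber, it lies in `V(𝒜)`. -/
noncomputable def FaceFlag.cochain {p : ℕ} (𝔉 : 𝒜.FaceFlag p) : 𝒜.FaceAlgebra R :=
  MonoidAlgebra.of R 𝒜.Face (𝔉.face (Fin.last p)) *
    diffProd R 𝒜 p fun i => 𝔉.face i.castSucc

open Classical in
/-- The element `𝒳 ⊗ C` of `⨁_{X ∈ L_p(𝒜)} Fl_p(𝒜_X) ⊗ V(𝒜^X)`, for `X` in `L_p(𝒜)`, a flag `𝒳` in
`flag_p(L(𝒜_X))` and a chamber `C` of `𝒜^X`. -/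
noncomputable def Source.tmul {p : ℕ} (X : 𝒜.L p) (𝒳 : 𝒜.LocalFlag p X.1)
    (C : 𝒜.Chamber X.1) : 𝒜.Source R p :=
  DirectSum.of (fun X : 𝒜.L p => 𝒜.FlV R p X.1) X (FlV.tmul R 𝒜 (Fl.of R 𝒜 𝒳) (V.of R 𝒜 C))

end Algebra

/-- `f(𝔉) = (𝒳, C)`: the flag `|𝔉|` is `𝒳`, and the last face of `𝔉` is `C`. -/
def FaceFlag.LiesOver {ι W : Type*} [AddCommGroup W] [Module ℝ W] {𝒜 : HypArrangement ι W} {p : ℕ}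
    (𝔉 : 𝒜.FaceFlag p) {X : 𝒜.L p} (𝒳 : 𝒜.LocalFlag p X.1) (C : 𝒜.Chamber X.1) : Prop :=
  (∀ i, (𝔉.face i).support = 𝒳.flat i) ∧ 𝔉.face (Fin.last p) = C.1

end HypArrangement

/-! The signed cochain ε(𝔉) b(𝔉) is the value at F_p of a composite of boundary operators that
depend only on the flats |F_i|; this makes it independent of the choice of 𝔉. For flats X < Y of
consecutive codimensions, `boundary` sends a face C with |C| = Y to the sum of the faces F with |F|
= X whose closure contains C, weighted by incidence numbers. As X/Y is a line, there are two such
faces, CG and C·(opposite of G) for any G with |G| = X, and their incidence numbers are opposite.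
Hence C goes to ± C(G - opposite of G), by `boundary_of_eq_smul`, and iteration along a flag gives
the signed cochain, by `flagBoundary_of`.

The relations of Fl_p hold because, as for a cellular boundary, the composites X ← Y ← Z sum to zero
over Y when X and Z differ by two in codimension (`sum_boundary_mul_boundary`). This is a statement
in the plane |E|/|D|: a face E ≤ D two codimensions lower is a sector, and the two rays that bound
it carry opposite products of incidence numbers (`Face.sum_incidence_mul_incidence`).

The image lies in W^p because the transpose of each factor F - (opposite of F) lowers the degree of
polynomial functions (`sub_opp_smul_mem_filtW`). The map commutes with the action of a face F
because left multiplication by F changes only the leading factor C, while the sign can be computed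
from the other factors. When F kills C in V(𝒜^X), the product vanishes, since one of the differences
telescopes to zero (`of_mul_diffProd_eq_zero`). Uniqueness holds because the tensors of flags with
chambers generate the source and each of them has a flag of faces over it. -/

namespace HypArrangement

/-! ### Flats, supports and face products. -/

section FlatGeometry

variable {ι W : Type*} [AddCommGroup W] [Module ℝ W] {𝒜 : HypArrangement ι W}

theorem Flat.le_iff_forall_hyp {X Y : 𝒜.Flat} :
    X ≤ Y ↔ ∀ i, X.carrier ≤ 𝒜.hyp i → Y.carrier ≤ 𝒜.hyp i := by
  constructor
  · exact fun h i hi => le_trans h hi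
  · intro h
    obtain ⟨S, hS⟩ := X.isInter
    change Y.carrier ≤ X.carrier
    rw [hS]
    refine le_iInf₂ fun i hi => h i ?_
    rw [hS]
    exact iInf₂_le i hi

/-- The intersection of a flat and a hyperplane. -/
def Flat.infHyp (X : 𝒜.Flat) (i : ι) : 𝒜.Flat :=
  ⟨X.carrier ⊓ 𝒜.hyp i, by
    obtain ⟨S, hS⟩ := X.isInter
    exact ⟨insert i S, by rw [iInf_insert, ← hS, inf_comm]⟩⟩

theorem Flat.le_infHyp (X : 𝒜.Flat) (i : ι) : X ≤ X.infHyp i :=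
  inf_le_left (a := X.carrier) (b := 𝒜.hyp i)

theorem Flat.infHyp_le {X Y : 𝒜.Flat} {i : ι} (h : X ≤ Y) (hi : Y.carrier ≤ 𝒜.hyp i) :
    X.infHyp i ≤ Y :=
  show Y.carrier ≤ X.carrier ⊓ 𝒜.hyp i from le_inf h hi

theorem Flat.lt_infHyp {X : 𝒜.Flat} {i : ι} (h : ¬ X.carrier ≤ 𝒜.hyp i) : X < X.infHyp i := by
  refine lt_of_le_of_ne (X.le_infHyp i) fun he => h ?_
  rw [he]
  exact inf_le_right

theorem Flat.exists_hyp_of_lt {X Y : 𝒜.Flat} (h : X < Y) :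
    ∃ i, Y.carrier ≤ 𝒜.hyp i ∧ ¬ X.carrier ≤ 𝒜.hyp i := by
  by_contra! hc
  exact h.not_ge (Flat.le_iff_forall_hyp.2 hc)

theorem wholeFlat_le (X : 𝒜.Flat) : 𝒜.wholeFlat ≤ X := le_top (a := X.carrier)

theorem Face.mem_support_of_mem {F : 𝒜.Face} {w : W} (h : w ∈ F.points) :
    w ∈ F.support.carrier :=
  (F.support_isLeast F.support).2 le_rfl h

theorem Face.sgn_eq_zero_of_le {F : 𝒜.Face} {Y : 𝒜.Flat} (h : Y ≤ F.support) {i : ι}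
    (hi : Y.carrier ≤ 𝒜.hyp i) : F.sgn i = 0 :=
  (F.sgn_eq_zero_iff i).2 (le_trans h hi)

theorem Face.mem_support_iff {F : 𝒜.Face} {w : W} :
    w ∈ F.support.carrier ↔ ∀ i, F.sgn i = 0 → 𝒜.form i w = 0 := by
  simp only [Face.support, Submodule.mem_iInf]
  rfl

theorem Face.support_opp (F : 𝒜.Face) : F.opp.support = F.support :=
  Face.support_eq_of_sgn fun i => by simp [Face.opp]

theorem Face.neg_mem_opp {F : 𝒜.Face} {w : W} (h : w ∈ F.points) : -w ∈ F.opp.points := by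
  intro i
  rw [map_neg, Left.sign_neg, h i]
  rfl

theorem Face.points_nonempty (F : 𝒜.Face) : ∃ w, w ∈ F.points := F.realized

theorem Face.support_mono {F G : 𝒜.Face} (h : F ≤ G) : F.support ≤ G.support := by
  refine (Face.le_support_iff G F.support).2 fun i hi => ?_
  rcases h i with h | h
  · exact h
  · rw [h]
    exact (F.sgn_eq_zero_iff i).2 hi

/-- The face that contains a given point. -/
noncomputable def faceOf (w : W) : 𝒜.Face := ⟨fun i => SignType.sign (𝒜.form i w), w, fun _ => rfl⟩

section FaceProduct

variable [Finite ι]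

/-- A generic point of X avoids the finitely many hyperplanes that do not contain X; its face has
support X. -/
theorem Flat.exists_face (X : 𝒜.Flat) : ∃ F : 𝒜.Face, F.support = X := by
  obtain ⟨w, hw, h⟩ := Module.Dual.exists_forall_mem_ne_zero_of_forall_exists X.carrier
    (fun i : {i // ¬ X.carrier ≤ 𝒜.hyp i} => 𝒜.form i) (fun i => by
      obtain ⟨x, hx, hxi⟩ := SetLike.not_le_iff_exists.1 i.2
      exact ⟨x, hx, hxi⟩)
  refine ⟨faceOf w, ?_⟩
  have key : ∀ i, (faceOf w : 𝒜.Face).support.carrier ≤ 𝒜.hyp i ↔ X.carrier ≤ 𝒜.hyp i := by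
    intro i
    rw [← Face.sgn_eq_zero_iff]
    change SignType.sign (𝒜.form i w) = 0 ↔ _
    rw [sign_eq_zero_iff]
    constructor
    · intro h0
      by_contra hi
      exact h ⟨i, hi⟩ h0
    · exact fun hi => hi hw
  exact le_antisymm (Flat.le_iff_forall_hyp.2 fun i => (key i).1)
    (Flat.le_iff_forall_hyp.2 fun i => (key i).2)

theorem Face.mul_le (F G : 𝒜.Face) : F * G ≤ F := fun i => by
  rw [Face.mul_sgn]
  by_cases h : F.sgn i = 0 <;> simp [h]

theorem Face.mul_eq_left {F G : 𝒜.Face} (h : F.support ≤ G.support) : F * G = F := by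
  refine Face.ext (funext fun i => ?_)
  rw [Face.mul_sgn]
  by_cases h0 : F.sgn i = 0
  · rw [if_neg (by simpa using h0), h0]
    exact Face.sgn_eq_zero_of_le h ((F.sgn_eq_zero_iff i).1 h0)
  · simp [h0]

/-- At a hyperplane that contains C but not G, the two products have the opposite nonzero signs of G
and its opposite. -/
theorem Face.mul_ne_mul_opp {C G : 𝒜.Face} (h : G.support < C.support) :
    C * G ≠ C * G.opp := by
  obtain ⟨i, hi, hX⟩ := Flat.exists_hyp_of_lt h
  intro he
  have := congrArg (fun F : 𝒜.Face => F.sgn i) he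
  simp only [Face.mul_sgn, (C.sgn_eq_zero_iff i).2 hi, Face.opp] at this
  simp only [ne_eq, not_true_eq_false, if_false] at this
  exact hX ((G.sgn_eq_zero_iff i).1 (SignType.self_eq_neg_iff.1 this))

end FaceProduct

/-! ### Codimension, and pairs of flats whose codimensions differ by one. -/

section Codim

variable [FiniteDimensional ℝ W]

theorem Flat.codim_add (X : 𝒜.Flat) :
    X.codim + Module.finrank ℝ X.carrier = Module.finrank ℝ W :=
  Submodule.finrank_quotient_add_finrank X.carrier

theorem Flat.codim_lt {X Y : 𝒜.Flat} (h : X < Y) : X.codim < Y.codim := by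
  have h' : Y.carrier < X.carrier := lt_of_le_of_ne h.le fun he => h.ne (Flat.ext he.symm)
  have := Submodule.finrank_lt_finrank_of_lt h'
  have := X.codim_add
  have := Y.codim_add
  omega

theorem Flat.eq_of_le_of_codim {X Y : 𝒜.Flat} (h : X ≤ Y) (hc : Y.codim ≤ X.codim) : X = Y := by
  by_contra hne
  exact absurd (Flat.codim_lt (lt_of_le_of_ne h hne)) (by omega)

theorem Flat.eq_wholeFlat_of_codim {X : 𝒜.Flat} (h : X.codim = 0) : X = 𝒜.wholeFlat :=
  (Flat.eq_of_le_of_codim (wholeFlat_le X) (by omega)).symm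

/-- Counting codimensions forces X ∩ H_i = Y. This is how the fact that X/Y is a line enters the
later arguments. -/
theorem Flat.mem_of_form_eq_zero {X Y : 𝒜.Flat} (h : X ≤ Y) (hc : Y.codim = X.codim + 1) {i : ι}
    (hi : Y.carrier ≤ 𝒜.hyp i) (hX : ¬ X.carrier ≤ 𝒜.hyp i) {w : W} (hw : w ∈ X.carrier)
    (h0 : 𝒜.form i w = 0) : w ∈ Y.carrier := by
  have h1 := Flat.codim_lt (Flat.lt_infHyp hX)
  have h2 := Flat.eq_of_le_of_codim (Flat.infHyp_le h hi) (by omega)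
  rw [← h2]
  exact ⟨hw, h0⟩

/-- Two hyperplanes that contain `Y`, but not `X`, restrict to the same hyperplane of `X`. -/
theorem Flat.form_mul_form_comm {X Y : 𝒜.Flat} (h : X ≤ Y) (hc : Y.codim = X.codim + 1) {i j : ι}
    (hi : Y.carrier ≤ 𝒜.hyp i) (hX : ¬ X.carrier ≤ 𝒜.hyp i) (hj : Y.carrier ≤ 𝒜.hyp j)
    {v w : W} (hv : v ∈ X.carrier) (hw : w ∈ X.carrier) :
    𝒜.form i v * 𝒜.form j w = 𝒜.form i w * 𝒜.form j v := by
  -- This combination is chosen so that f_i kills it; it therefore lies in Y, and f_j kills it too.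
  have hm : 𝒜.form i v • w - 𝒜.form i w • v ∈ X.carrier :=
    X.carrier.sub_mem (X.carrier.smul_mem _ hw) (X.carrier.smul_mem _ hv)
  have h1 : 𝒜.form j (𝒜.form i v • w - 𝒜.form i w • v) = 0 :=
    hj (Flat.mem_of_form_eq_zero h hc hi hX hm (by
      simp only [map_sub, map_smul, smul_eq_mul]; ring))
  simp only [map_sub, map_smul, smul_eq_mul] at h1
  linarith

/-- Modulo |C| the subspace |F| is a line, so the forms vanishing on C are proportional on |F|. One
hyperplane that contains C but not F thus decides whether F lies on the side of G or on that of its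
opposite; the remaining signs of F are those of C. -/
theorem Face.eq_mul_or_eq_mul_opp [Finite ι] {C F G : 𝒜.Face} (hF : F ≤ C)
    (hc : C.codim = F.codim + 1) (hG : G.support = F.support) : F = C * G ∨ F = C * G.opp := by
  have hle := Face.support_mono hF
  have hlt : F.support < C.support := by
    refine lt_of_le_of_ne hle fun he => ?_
    rw [Face.codim, Face.codim, he] at hc
    omega
  obtain ⟨i, hi, hX⟩ := Flat.exists_hyp_of_lt hlt
  obtain ⟨w, hw⟩ := F.points_nonempty
  obtain ⟨g, hg⟩ := G.points_nonempty
  have key : ∀ j, C.sgn j = 0 → F.sgn i * G.sgn j = G.sgn i * F.sgn j := by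
    intro j hj
    have := Flat.form_mul_form_comm hle hc hi hX ((C.sgn_eq_zero_iff j).1 hj)
      (Face.mem_support_of_mem hw) (hG ▸ Face.mem_support_of_mem hg)
    rw [← hw i, ← hw j, ← hg i, ← hg j, ← sign_mul, ← sign_mul, this]
  have hFi : F.sgn i ≠ 0 := fun h => hX ((F.sgn_eq_zero_iff i).1 h)
  have hGi : G.sgn i ≠ 0 := fun h => hX (hG ▸ (G.sgn_eq_zero_iff i).1 h)
  have hopp : ∀ a b : SignType, a ≠ 0 → b ≠ 0 → a ≠ b → a = -b := by decide
  have hcanc : ∀ a b c : SignType, a ≠ 0 → a * b = a * c → b = c := by decide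
  have hcanc' : ∀ a b c : SignType, a ≠ 0 → -a * b = a * c → c = -b := by decide
  by_cases h : F.sgn i = G.sgn i
  · left
    refine Face.ext (funext fun j => ?_)
    rw [Face.mul_sgn]
    by_cases hj : C.sgn j = 0
    · have := key j hj
      rw [h] at this
      simp [hj, hcanc _ _ _ hGi this]
    · rcases hF j with h1 | h1
      · exact absurd h1 hj
      · simp [h1 ▸ hj, h1]
  · right
    refine Face.ext (funext fun j => ?_)
    rw [Face.mul_sgn]
    by_cases hj : C.sgn j = 0
    · have := key j hj
      rw [hopp _ _ hFi hGi h] at this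
      simp [hj, Face.opp, hcanc' _ _ _ hGi this]
    · rcases hF j with h1 | h1
      · exact absurd h1 hj
      · simp [h1 ▸ hj, h1]

end Codim

end FlatGeometry

end HypArrangement

/-! ### Alternating forms of top degree on a quotient space. -/

section AlternatingForms

variable {M : Type*} [AddCommGroup M] [Module ℝ M]

/-- Replacing the entries of u by those of v one at a time changes g by its value at a family with
an entry in X, which is zero. -/
theorem AlternatingMap.apply_eq_of_sub_mem {n : ℕ} (g : M [⋀^Fin n]→ₗ[ℝ] ℝ) (X : Submodule ℝ M)
    (h : ∀ u j, u j ∈ X → g u = 0) {u v : Fin n → M} (huv : ∀ j, u j - v j ∈ X) :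
    g u = g v := by
  have key : ∀ s : Finset (Fin n), g (s.piecewise v u) = g u := by
    intro s
    induction s using Finset.induction_on with
    | empty => simp
    | insert j s hj ih =>
      rw [Finset.piecewise_insert, ← ih, ← sub_sub_cancel (u j) (v j), AlternatingMap.map_update_sub,
        h (Function.update _ j (u j - v j)) j (by simpa using huv j), sub_zero]
      congr 1
      rw [Function.update_eq_self_iff, Finset.piecewise_eq_of_notMem _ _ _ hj]
  simpa using (key Finset.univ).symm

/-- The form g descends to M/X, where forms of top degree make up a line spanned by α. A linear
section of the quotient map realizes the descent. -/
theorem AlternatingMap.exists_eq_mul_of_finrank_quotient {k : ℕ} {X : Submodule ℝ M}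
    [FiniteDimensional ℝ (M ⧸ X)] (hk : Module.finrank ℝ (M ⧸ X) = k)
    {α : (M ⧸ X) [⋀^Fin k]→ₗ[ℝ] ℝ} (hα : α ≠ 0) (g : M [⋀^Fin k]→ₗ[ℝ] ℝ)
    (h : ∀ u j, u j ∈ X → g u = 0) : ∃ c : ℝ, ∀ u, g u = c * α fun j => X.mkQ (u j) := by
  obtain ⟨s, hs⟩ := X.mkQ.exists_rightInverse_of_surjective (Submodule.range_mkQ X)
  let b := Module.finBasisOfFinrankEq ℝ (M ⧸ X) hk
  have hαb : α b ≠ 0 := fun h0 => hα (by rw [α.eq_smul_basis_det b, h0, zero_smul])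
  refine ⟨(g.compLinearMap s) b / α b, fun u => ?_⟩
  have h1 : g u = (g.compLinearMap s) fun j => X.mkQ (u j) := by
    refine g.apply_eq_of_sub_mem X h fun j => ?_
    have h2 : X.mkQ (u j - s (X.mkQ (u j))) = 0 := by
      rw [map_sub, sub_eq_zero]
      exact (LinearMap.congr_fun hs (X.mkQ (u j))).symm
    rwa [Submodule.mkQ_apply, Submodule.Quotient.mk_eq_zero] at h2
  have h2 := AlternatingMap.congr_fun ((g.compLinearMap s).eq_smul_basis_det b)
    fun j => X.mkQ (u j)
  have h3 := AlternatingMap.congr_fun (α.eq_smul_basis_det b) fun j => X.mkQ (u j)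
  rw [AlternatingMap.smul_apply, smul_eq_mul] at h2 h3
  rw [h1, h2, h3]
  field_simp

/-- If the i-th coordinate of m is nonzero, m can replace the i-th basis vector; a transposition
then moves it to the front. -/
theorem AlternatingMap.exists_cons_ne_zero {k : ℕ} [FiniteDimensional ℝ M]
    (hk : Module.finrank ℝ M = k + 1) {β : M [⋀^Fin (k + 1)]→ₗ[ℝ] ℝ} (hβ : β ≠ 0) {m : M}
    (hm : m ≠ 0) : ∃ u : Fin k → M, β (Fin.cons m u) ≠ 0 := by
  let b := Module.finBasisOfFinrankEq ℝ M hk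
  have hb : β b ≠ 0 := fun h0 => hβ (by rw [β.eq_smul_basis_det b, h0, zero_smul])
  obtain ⟨i, hi⟩ : ∃ i, b.repr m i ≠ 0 := by
    by_contra! h
    exact hm (b.repr.map_eq_zero_iff.1 (Finsupp.ext h))
  have h1 : β (Function.update b i m) = b.repr m i * β b := by
    conv_lhs => rw [← b.sum_repr m]
    rw [AlternatingMap.map_update_sum, Finset.sum_eq_single i]
    · rw [AlternatingMap.map_update_smul, Function.update_eq_self, smul_eq_mul]
    · intro j _ hj
      rw [AlternatingMap.map_update_smul, AlternatingMap.map_update_self _ _ hj.symm, smul_zero]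
    · simp
  let v : Fin (k + 1) → M := Function.update b i m ∘ Equiv.swap 0 i
  have hv : Fin.cons m (Fin.tail v) = v := by
    have : v 0 = m := by simp [v]
    rw [← this]
    exact Fin.cons_self_tail v
  refine ⟨Fin.tail v, ?_⟩
  rw [hv, AlternatingMap.map_perm, h1]
  rw [smul_ne_zero_iff_ne]
  exact mul_ne_zero hi hb

end AlternatingForms

namespace HypArrangement

/-! ### Contraction of volume forms and incidence numbers. -/

section Orientations

variable {ι W : Type*} [AddCommGroup W] [Module ℝ W] {𝒜 : HypArrangement ι W}

/-- A positive volume form on `W ⧸ X`. -/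
noncomputable def Coorientation.vol (o : 𝒜.Coorientation) {k : ℕ} (X : 𝒜.L k) :
    (W ⧸ X.1.carrier) [⋀^Fin k]→ₗ[ℝ] ℝ := (o k X).someVector

theorem Coorientation.vol_ne_zero (o : 𝒜.Coorientation) {k : ℕ} (X : 𝒜.L k) : o.vol X ≠ 0 :=
  Module.Ray.someVector_ne_zero _

theorem Coorientation.rayOfNeZero_vol (o : 𝒜.Coorientation) {k : ℕ} (X : 𝒜.L k) :
    rayOfNeZero ℝ (o.vol X) (o.vol_ne_zero X) = o k X :=
  Module.Ray.someVector_ray _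

theorem Coorientation.exists_vol_ne_zero (o : 𝒜.Coorientation) {k : ℕ} (X : 𝒜.L k) :
    ∃ u : Fin k → W, o.vol X (fun j => X.1.carrier.mkQ (u j)) ≠ 0 := by
  by_contra! h
  refine o.vol_ne_zero X (AlternatingMap.ext fun u => ?_)
  choose v hv using fun j => Submodule.mkQ_surjective X.1.carrier (u j)
  rw [← funext hv]
  exact h v

/-- `c` is the factor by which the contraction of the volume form of `W ⧸ Y` with vectors of `X`
differs from the volume form of `W ⧸ X`. -/
def IsContraction (o : 𝒜.Coorientation) {k : ℕ} (X : 𝒜.L k) (Y : 𝒜.L (k + 1)) (c : W →ₗ[ℝ] ℝ) :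
    Prop :=
  ∀ w ∈ X.1.carrier, ∀ u : Fin k → W,
    o.vol Y (Fin.cons (Y.1.carrier.mkQ w) fun j => Y.1.carrier.mkQ (u j)) =
      c w * o.vol X fun j => X.1.carrier.mkQ (u j)

theorem mkQ_cons (Y : 𝒜.Flat) {k : ℕ} (w : W) (u : Fin k → W) :
    (fun j => Y.carrier.mkQ ((Fin.cons w u : Fin (k + 1) → W) j)) =
      Fin.cons (Y.carrier.mkQ w) fun j => Y.carrier.mkQ (u j) := by
  funext j
  refine Fin.cases ?_ (fun j => ?_) j <;> simp

/-- Contraction of the volume form of `W ⧸ Y` with a vector, pulled back to `W`. -/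
noncomputable def contractVol (o : 𝒜.Coorientation) {k : ℕ} (Y : 𝒜.L (k + 1)) (w : W) :
    W [⋀^Fin k]→ₗ[ℝ] ℝ :=
  ((o.vol Y).curryLeft (Y.1.carrier.mkQ w)).compLinearMap Y.1.carrier.mkQ

theorem contractVol_apply (o : 𝒜.Coorientation) {k : ℕ} (Y : 𝒜.L (k + 1)) (w : W)
    (u : Fin k → W) : contractVol o Y w u =
      o.vol Y (Fin.cons (Y.1.carrier.mkQ w) fun j => Y.1.carrier.mkQ (u j)) := rfl

theorem vol_cons_of_mem (o : 𝒜.Coorientation) {k : ℕ} (Y : 𝒜.L (k + 1)) {w : W}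
    (hw : w ∈ Y.1.carrier) (u : Fin k → W ⧸ Y.1.carrier) :
    o.vol Y (Fin.cons (Y.1.carrier.mkQ w) u) = 0 := by
  refine AlternatingMap.map_coord_zero _ 0 ?_
  rw [Fin.cons_zero, Submodule.mkQ_apply, Submodule.Quotient.mk_eq_zero]
  exact hw

namespace IsContraction

variable {o : 𝒜.Coorientation} {k : ℕ} {X : 𝒜.L k} {Y : 𝒜.L (k + 1)} {c : W →ₗ[ℝ] ℝ}

theorem lt (h : X.1 ≤ Y.1) : X.1 < Y.1 := by
  refine lt_of_le_of_ne h fun he => ?_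
  have h1 := X.2
  have h2 := Y.2
  rw [he] at h1
  omega

theorem apply_eq_zero (hc : IsContraction o X Y c) (h : X.1 ≤ Y.1) {w : W}
    (hw : w ∈ Y.1.carrier) : c w = 0 := by
  obtain ⟨v, hv⟩ := o.exists_vol_ne_zero X
  have := hc w (h hw) v
  rw [vol_cons_of_mem o Y hw] at this
  exact (mul_eq_zero.1 this.symm).resolve_right hv

end IsContraction

variable [FiniteDimensional ℝ W]

/-- Two vectors of X are linearly dependent modulo Y, and an alternating form vanishes on them.
Hence the contraction descends to W/X. -/
theorem contractVol_eq_zero (o : 𝒜.Coorientation) {k : ℕ} {X : 𝒜.L k} {Y : 𝒜.L (k + 1)}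
    (h : X.1 ≤ Y.1) {w : W} (hw : w ∈ X.1.carrier) (u : Fin k → W) (j : Fin k)
    (hj : u j ∈ X.1.carrier) : contractVol o Y w u = 0 := by
  rw [contractVol_apply]
  by_cases hY : w ∈ Y.1.carrier
  · exact vol_cons_of_mem o Y hY _
  · obtain ⟨i, hi, hX⟩ := Flat.exists_hyp_of_lt (IsContraction.lt h)
    have hc : Y.1.codim = X.1.codim + 1 := by rw [X.2, Y.2]
    have hwi : 𝒜.form i w ≠ 0 := fun h0 => hY (Flat.mem_of_form_eq_zero h hc hi hX hw h0)
    have hz : u j - (𝒜.form i (u j) / 𝒜.form i w) • w ∈ Y.1.carrier := by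
      refine Flat.mem_of_form_eq_zero h hc hi hX
        (X.1.carrier.sub_mem hj (X.1.carrier.smul_mem _ hw)) ?_
      rw [map_sub, map_smul, smul_eq_mul]
      field_simp
      ring
    rw [← Submodule.Quotient.mk_eq_zero, Submodule.Quotient.mk_sub, Submodule.Quotient.mk_smul,
      sub_eq_zero] at hz
    change Y.1.carrier.mkQ (u j) = _ • Y.1.carrier.mkQ w at hz
    set V : Fin (k + 1) → W ⧸ Y.1.carrier :=
      Fin.cons (Y.1.carrier.mkQ w) fun j => Y.1.carrier.mkQ (u j) with hV
    have h0 : V 0 = Y.1.carrier.mkQ w := rfl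
    have hj' : V j.succ = (𝒜.form i (u j) / 𝒜.form i w) • V 0 := hz
    rw [← Function.update_eq_self j.succ V, hj', AlternatingMap.map_update_smul,
      AlternatingMap.map_update_self _ _ (Fin.succ_ne_zero j), smul_zero]

theorem exists_isContraction (o : 𝒜.Coorientation) {k : ℕ} {X : 𝒜.L k} {Y : 𝒜.L (k + 1)}
    (h : X.1 ≤ Y.1) : ∃ c, IsContraction o X Y c := by
  obtain ⟨v, hv⟩ := o.exists_vol_ne_zero X
  -- The factor is read off at one family v where the volume form of W/X does not vanish; this makes
  -- it linear in w on all of W, although only its values on X are meaningful.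
  let c : W →ₗ[ℝ] ℝ := (o.vol X fun j => X.1.carrier.mkQ (v j))⁻¹ •
    { toFun w := contractVol o Y w v
      map_add' a b := by simp [contractVol]
      map_smul' r a := by simp [contractVol] }
  have hc : ∀ w, c w = (o.vol X fun j => X.1.carrier.mkQ (v j))⁻¹ * contractVol o Y w v :=
    fun w => rfl
  refine ⟨c, fun w hw u => ?_⟩
  obtain ⟨t, ht⟩ := AlternatingMap.exists_eq_mul_of_finrank_quotient X.2 (o.vol_ne_zero X)
    (contractVol o Y w) (contractVol_eq_zero o h hw)
  rw [← contractVol_apply, ht, hc, ht]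
  field_simp

namespace IsContraction

variable {o : 𝒜.Coorientation} {k : ℕ} {X : 𝒜.L k} {Y : 𝒜.L (k + 1)} {c : W →ₗ[ℝ] ℝ}

theorem apply_ne_zero (hc : IsContraction o X Y c) {w : W} (hw : w ∈ X.1.carrier)
    (hY : w ∉ Y.1.carrier) : c w ≠ 0 := by
  intro h0
  obtain ⟨u, hu⟩ := AlternatingMap.exists_cons_ne_zero Y.2 (o.vol_ne_zero Y)
    (m := Y.1.carrier.mkQ w)
    (by rwa [Submodule.mkQ_apply, ne_eq, Submodule.Quotient.mk_eq_zero])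
  choose v hv using fun j => Submodule.mkQ_surjective Y.1.carrier (u j)
  rw [← funext hv, hc w hw, h0, zero_mul] at hu
  exact hu rfl

/-- On X both c and f_i vanish on Y, and X/Y is a line, so they are proportional there. Consequently
the sign of c is constant on each face with support X. -/
theorem mul_form_comm (hc : IsContraction o X Y c) (h : X.1 ≤ Y.1) {i : ι}
    (hi : Y.1.carrier ≤ 𝒜.hyp i) (hX : ¬ X.1.carrier ≤ 𝒜.hyp i) {v w : W}
    (hv : v ∈ X.1.carrier) (hw : w ∈ X.1.carrier) :
    c v * 𝒜.form i w = c w * 𝒜.form i v := by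
  have hm : 𝒜.form i v • w - 𝒜.form i w • v ∈ X.1.carrier :=
    X.1.carrier.sub_mem (X.1.carrier.smul_mem _ hw) (X.1.carrier.smul_mem _ hv)
  have h1 := hc.apply_eq_zero h (Flat.mem_of_form_eq_zero h (by rw [X.2, Y.2]) hi hX hm (by
      simp only [map_sub, map_smul, smul_eq_mul]; ring))
  simp only [map_sub, map_smul, smul_eq_mul] at h1
  linarith

theorem sign_apply_comm (hc : IsContraction o X Y c) (h : X.1 ≤ Y.1) {i : ι}
    (hi : Y.1.carrier ≤ 𝒜.hyp i) (hX : ¬ X.1.carrier ≤ 𝒜.hyp i) {F G : 𝒜.Face}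
    (hF : F.support = X.1) (hG : G.support = X.1) {v w : W} (hv : v ∈ F.points)
    (hw : w ∈ G.points) :
    SignType.sign (c v) * G.sgn i = SignType.sign (c w) * F.sgn i := by
  rw [← hv i, ← hw i, ← sign_mul, ← sign_mul, hc.mul_form_comm h hi hX
    (hF ▸ Face.mem_support_of_mem hv) (hG ▸ Face.mem_support_of_mem hw)]

end IsContraction

/-- The existential choices of w, α and β do not matter: positive forms differ by positive factors,
and c has the same sign at all points of F. -/
theorem eps_eq_sign (o : 𝒜.Coorientation) {k : ℕ} {F : 𝒜.FaceOfCodim k}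
    {G : 𝒜.FaceOfCodim (k + 1)} (h : F.1.support ≤ G.1.support) {c : W →ₗ[ℝ] ℝ}
    (hc : IsContraction o ⟨F.1.support, F.2⟩ ⟨G.1.support, G.2⟩ c) {w : W} (hw : w ∈ F.1.points) :
    eps o F G = (SignType.sign (c w) : ℤ) := by
  have hlt : F.1.support < G.1.support :=
    IsContraction.lt (X := ⟨F.1.support, F.2⟩) (Y := ⟨G.1.support, G.2⟩) h
  obtain ⟨i, hi, hX⟩ := Flat.exists_hyp_of_lt hlt
  have hFi : F.1.sgn i ≠ 0 := fun h => hX ((F.1.sgn_eq_zero_iff i).1 h)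
  have hY : w ∉ G.1.support.carrier := fun hw' => hFi (by
    rw [← hw i, show 𝒜.form i w = 0 from hi hw', sign_zero])
  have hne : c w ≠ 0 := hc.apply_ne_zero (Face.mem_support_of_mem hw) hY
  have hiff : OrientationsAgree o F G ↔ 0 < c w := by
    constructor
    · rintro ⟨v, hv, α, β, hα, hβ, hrα, hrβ, hαβ⟩
      rw [← o.rayOfNeZero_vol ⟨F.1.support, F.2⟩, ray_eq_iff] at hrα
      rw [← o.rayOfNeZero_vol ⟨G.1.support, G.2⟩, ray_eq_iff] at hrβ
      obtain ⟨a, ha, rfl⟩ := hrα.symm.exists_pos_left (o.vol_ne_zero _) hα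
      obtain ⟨b, hb, rfl⟩ := hrβ.symm.exists_pos_left (o.vol_ne_zero _) hβ
      obtain ⟨u, hu⟩ := o.exists_vol_ne_zero ⟨F.1.support, F.2⟩
      have h1 := hαβ u
      rw [AlternatingMap.smul_apply, AlternatingMap.smul_apply, smul_eq_mul, smul_eq_mul,
        hc v (Face.mem_support_of_mem hv) u, ← mul_assoc] at h1
      have h2 := mul_right_cancel₀ hu h1
      have h3 : 0 < c v := by
        by_contra! hcv
        nlinarith
      have h4 := hc.sign_apply_comm h hi hX rfl rfl hv hw
      rw [sign_pos h3, one_mul] at h4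
      rw [← sign_eq_one_iff]
      revert hFi h4
      generalize F.1.sgn i = s
      generalize SignType.sign (c w) = t
      revert s t
      decide
    · intro hpos
      refine ⟨w, hw, c w • o.vol ⟨F.1.support, F.2⟩, o.vol ⟨G.1.support, G.2⟩,
        smul_ne_zero hne (o.vol_ne_zero _), o.vol_ne_zero _, ?_, o.rayOfNeZero_vol _, fun u => ?_⟩
      · rw [← o.rayOfNeZero_vol ⟨F.1.support, F.2⟩, ray_eq_iff]
        exact SameRay.sameRay_pos_smul_left _ hpos
      · rw [hc w (Face.mem_support_of_mem hw) u, AlternatingMap.smul_apply, smul_eq_mul]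
  rw [eps]
  split_ifs with hag
  · rw [sign_pos (hiff.1 hag)]
    rfl
  · rw [sign_neg (lt_of_le_of_ne (not_lt.1 fun hp => hag (hiff.2 hp)) hne)]
    rfl

open Classical in
/-- The incidence number of a face `F` and a flat `Y` that covers `|F|`. It is `ε(F, G)` for all
faces `G` with `|G| = Y`. -/
noncomputable def incidence (o : 𝒜.Coorientation) (F : 𝒜.Face) (Y : 𝒜.Flat) : ℤ :=
  if h : F.support ≤ Y ∧ Y.codim = F.codim + 1 then
    (SignType.sign ((exists_isContraction o (X := ⟨F.support, rfl⟩) (Y := ⟨Y, h.2⟩) h.1).choose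
      F.points_nonempty.choose) : ℤ)
  else 0

theorem incidence_eq_sign (o : 𝒜.Coorientation) {F : 𝒜.Face} {X Y : 𝒜.Flat} {k : ℕ}
    (hF : F.support = X) (hX : X.codim = k)
    (hY : Y.codim = k + 1) (h : X ≤ Y) {c : W →ₗ[ℝ] ℝ}
    (hc : IsContraction o ⟨X, hX⟩ ⟨Y, hY⟩ c) {w : W} (hw : w ∈ F.points) :
    incidence o F Y = (SignType.sign (c w) : ℤ) := by
  subst hF hX
  rw [incidence, dif_pos ⟨h, hY⟩]
  set e := exists_isContraction o (X := ⟨F.support, rfl⟩) (Y := ⟨Y, hY⟩) h with he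
  obtain ⟨v, hv⟩ := o.exists_vol_ne_zero ⟨F.support, rfl⟩
  have heq : ∀ w ∈ F.support.carrier, e.choose w = c w := fun w hw =>
    mul_right_cancel₀ hv ((e.choose_spec w hw v).symm.trans (hc w hw v))
  have hw' : F.points_nonempty.choose ∈ F.points := F.points_nonempty.choose_spec
  obtain ⟨i, hi, hX⟩ := Flat.exists_hyp_of_lt
    (IsContraction.lt (X := ⟨F.support, rfl⟩) (Y := ⟨Y, hY⟩) h)
  have hFi : F.sgn i ≠ 0 := fun h => hX ((F.sgn_eq_zero_iff i).1 h)
  have h4 := hc.sign_apply_comm h hi hX rfl rfl hw' hw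
  rw [heq _ (Face.mem_support_of_mem hw')]
  congr 1
  revert hFi h4
  generalize F.sgn i = s
  generalize SignType.sign (c w) = t
  generalize SignType.sign (c _) = t'
  revert s t t'
  decide

theorem eps_eq_incidence (o : 𝒜.Coorientation) {k : ℕ} {F : 𝒜.FaceOfCodim k}
    {G : 𝒜.FaceOfCodim (k + 1)} (h : F.1.support ≤ G.1.support) :
    eps o F G = incidence o F.1 G.1.support := by
  obtain ⟨c, hc⟩ := exists_isContraction o (X := ⟨F.1.support, F.2⟩) (Y := ⟨G.1.support, G.2⟩) h
  obtain ⟨w, hw⟩ := F.1.points_nonempty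
  rw [eps_eq_sign o h hc hw, incidence_eq_sign o rfl F.2 G.2 h hc hw]

theorem incidence_ne_zero (o : 𝒜.Coorientation) {F : 𝒜.Face} {Y : 𝒜.Flat}
    (h : F.support ≤ Y) (hc : Y.codim = F.support.codim + 1) : incidence o F Y ≠ 0 := by
  have hlt := IsContraction.lt (X := ⟨F.support, rfl⟩) (Y := ⟨Y, hc⟩) h
  obtain ⟨c, hc⟩ := exists_isContraction o (X := ⟨F.support, rfl⟩) (Y := ⟨Y, hc⟩) h
  obtain ⟨w, hw⟩ := F.points_nonempty
  obtain ⟨i, hi, hX⟩ := Flat.exists_hyp_of_lt hlt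
  have hFi : F.sgn i ≠ 0 := fun h => hX ((F.sgn_eq_zero_iff i).1 h)
  have hY : w ∉ Y.carrier := fun hw' => hFi (by
    rw [← hw i, show 𝒜.form i w = 0 from hi hw', sign_zero])
  have hne : c w ≠ 0 := hc.apply_ne_zero (Face.mem_support_of_mem hw) hY
  rw [incidence_eq_sign o rfl rfl _ h hc hw]
  rcases lt_or_gt_of_ne hne with h | h
  · simp [sign_neg h]
  · simp [sign_pos h]

theorem incidence_opp (o : 𝒜.Coorientation) {F : 𝒜.Face} {Y : 𝒜.Flat}
    (h : F.support ≤ Y) (hc : Y.codim = F.support.codim + 1) :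
    incidence o F.opp Y = - incidence o F Y := by
  obtain ⟨c, hc'⟩ := exists_isContraction o (X := ⟨F.support, rfl⟩) (Y := ⟨Y, hc⟩) h
  obtain ⟨w, hw⟩ := F.points_nonempty
  rw [incidence_eq_sign o rfl rfl hc h hc' hw,
    incidence_eq_sign o F.support_opp rfl hc h hc' (Face.neg_mem_opp hw), map_neg, Left.sign_neg]
  generalize SignType.sign (c w) = s
  revert s
  decide

/-- CF and F lie on the same side of any hyperplane that contains C but not F, and that side
determines the incidence number. -/
theorem incidence_mul [Finite ι] (o : 𝒜.Coorientation) {C F : 𝒜.Face}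
    (h : F.support ≤ C.support) (hc : C.support.codim = F.support.codim + 1) :
    incidence o (C * F) C.support = incidence o F C.support := by
  have hlt := IsContraction.lt (X := ⟨F.support, rfl⟩) (Y := ⟨C.support, hc⟩) h
  obtain ⟨c, hc'⟩ := exists_isContraction o (X := ⟨F.support, rfl⟩) (Y := ⟨C.support, hc⟩) h
  obtain ⟨w, hw⟩ := F.points_nonempty
  obtain ⟨v, hv⟩ := (C * F).points_nonempty
  have hs : (C * F).support = F.support := Face.support_mul C F h
  rw [incidence_eq_sign o rfl rfl hc h hc' hw, incidence_eq_sign o hs rfl hc h hc' hv]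
  obtain ⟨i, hi, hX⟩ := Flat.exists_hyp_of_lt hlt
  have hFi : F.sgn i ≠ 0 := fun h => hX ((F.sgn_eq_zero_iff i).1 h)
  have h4 := hc'.sign_apply_comm h hi hX hs rfl hv hw
  have hCi : (C * F).sgn i = F.sgn i := by
    rw [Face.mul_sgn, (C.sgn_eq_zero_iff i).2 hi]
    simp
  rw [hCi] at h4
  congr 1
  revert hFi h4
  generalize F.sgn i = s
  generalize SignType.sign (c w) = t
  generalize SignType.sign (c _) = t'
  revert s t t'
  decide

/-- Contraction of the volume form of `W ⧸ Z` with two vectors, compared with the volume form of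
`W ⧸ X`, for flats `X ≤ Z` whose codimensions differ by two. -/
theorem exists_area_form (o : 𝒜.Coorientation) {k : ℕ} (X : 𝒜.L k) (Z : 𝒜.L (k + 2)) :
    ∃ a : W →ₗ[ℝ] W →ₗ[ℝ] ℝ, (∀ w, a w w = 0) ∧ (∀ z ∈ Z.1.carrier, ∀ w, a z w = 0) ∧
      ∀ F E : 𝒜.Face, E.support = X.1 → X.1 ≤ F.support → F.support ≤ Z.1 →
        F.support.codim = k + 1 → ∀ f ∈ F.points, ∀ e ∈ E.points,
          incidence o F Z.1 * incidence o E F.support = (SignType.sign (a f e) : ℤ) := by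
  obtain ⟨v, hv⟩ := o.exists_vol_ne_zero X
  let a : W →ₗ[ℝ] W →ₗ[ℝ] ℝ := (o.vol X fun j => X.1.carrier.mkQ (v j))⁻¹ •
    LinearMap.mk₂ ℝ (fun f e => o.vol Z (Fin.cons (Z.1.carrier.mkQ f)
      (Fin.cons (Z.1.carrier.mkQ e) fun j => Z.1.carrier.mkQ (v j))))
      (fun x y z => by
        rw [map_add]; exact AlternatingMap.map_vecCons_add _ _ _ _)
      (fun r x y => by
        rw [map_smul]; exact AlternatingMap.map_vecCons_smul _ _ _ _)
      (fun x y z => by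
        rw [map_add]
        exact AlternatingMap.map_vecCons_add ((o.vol Z).curryLeft (Z.1.carrier.mkQ x)) _ _ _)
      (fun r x y => by
        rw [map_smul]
        exact AlternatingMap.map_vecCons_smul ((o.vol Z).curryLeft (Z.1.carrier.mkQ x)) _ _ _)
  have ha : ∀ f e, a f e = (o.vol X fun j => X.1.carrier.mkQ (v j))⁻¹ *
      o.vol Z (Fin.cons (Z.1.carrier.mkQ f)
      (Fin.cons (Z.1.carrier.mkQ e) fun j => Z.1.carrier.mkQ (v j))) := fun f e => rfl
  refine ⟨a, fun w => ?_, fun z hz w => ?_, fun F E hE hXF hFZ hF f hf e he => ?_⟩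
  · rw [ha, AlternatingMap.map_eq_zero_of_eq (o.vol Z) _ (i := 0) (j := 1) rfl (by simp), mul_zero]
  · rw [ha, vol_cons_of_mem o Z hz, mul_zero]
  · obtain ⟨c, hc⟩ := exists_isContraction o (X := X) (Y := ⟨F.support, hF⟩) hXF
    obtain ⟨d, hd⟩ := exists_isContraction o (X := ⟨F.support, hF⟩) (Y := Z) hFZ
    -- Contracting first with f ∈ |F| and then with e ∈ |E| splits off the two contraction factors
    -- in turn.
    have h1 : a f e = d f * c e := by
      have h2 := hd f (Face.mem_support_of_mem hf) (Fin.cons e v)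
      rw [mkQ_cons, mkQ_cons, hc e (hE ▸ Face.mem_support_of_mem he)] at h2
      rw [ha, h2]
      field_simp
    rw [incidence_eq_sign o rfl hF Z.2 hFZ hd hf, incidence_eq_sign o hE X.2 hF hXF hc he, h1,
      sign_mul]
    generalize SignType.sign (d f) = s
    generalize SignType.sign (c e) = t
    revert s t
    decide

end Orientations

/-! ### Faces between two faces whose codimensions differ by two. -/

section Diamond

variable {ι W : Type*} [AddCommGroup W] [Module ℝ W] {𝒜 : HypArrangement ι W}

theorem Face.form_mul_form_nonneg {E F : 𝒜.Face} (h : E ≤ F) {e f : W} (he : e ∈ E.points)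
    (hf : f ∈ F.points) (j : ι) : 0 ≤ 𝒜.form j f * 𝒜.form j e := by
  rw [← sign_nonneg_iff, sign_mul, he j, hf j]
  rcases h j with h | h
  · rw [h, zero_mul]
  · rw [h]
    generalize E.sgn j = s
    revert s
    decide

instance [Finite ι] : Finite 𝒜.Face :=
  Finite.of_injective Face.sgn fun _ _ => Face.ext

noncomputable instance [Finite ι] : Fintype 𝒜.Face := Fintype.ofFinite _

variable [FiniteDimensional ℝ W]

/-- In the plane |E|/|D|, F and F' are rays in the closure of the sector E. Equal products of
incidence numbers put both on the same side of the direction e, and a sector has only one bounding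
ray on each side. -/
theorem Face.eq_of_incidence_eq (o : 𝒜.Coorientation) {E F F' D : 𝒜.Face}
    (hD : D.codim = E.codim + 2) (hEF : E ≤ F) (hFD : F ≤ D) (hF : F.codim = E.codim + 1)
    (hEF' : E ≤ F') (hFD' : F' ≤ D) (hF' : F'.codim = E.codim + 1)
    (h : incidence o F D.support * incidence o E F.support =
      incidence o F' D.support * incidence o E F'.support) : F = F' := by
  obtain ⟨a, ha, haZ, hinc⟩ := exists_area_form o ⟨E.support, rfl⟩ ⟨D.support, hD⟩
  obtain ⟨e, he⟩ := E.points_nonempty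
  obtain ⟨f, hf⟩ := F.points_nonempty
  obtain ⟨f', hf'⟩ := F'.points_nonempty
  have hs := hinc F E rfl (Face.support_mono hEF) (Face.support_mono hFD) hF f hf e he
  rw [h, hinc F' E rfl (Face.support_mono hEF') (Face.support_mono hFD') hF' f' hf' e he] at hs
  have hne : incidence o F' D.support * incidence o E F'.support ≠ 0 :=
    mul_ne_zero (incidence_ne_zero o (Face.support_mono hFD') (by
      change D.codim = F'.codim + 1
      omega)) (incidence_ne_zero o (Face.support_mono hEF') hF')
  rw [hinc F' E rfl (Face.support_mono hEF') (Face.support_mono hFD') hF' f' hf' e he] at hne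
  have hsupp : ∀ {A B : 𝒜.Face}, A ≤ B → A.codim < B.codim → A.support < B.support :=
    fun hAB hc => lt_of_le_of_ne (Face.support_mono hAB) fun he => by
      rw [Face.codim, Face.codim, he] at hc
      exact lt_irrefl _ hc
  obtain ⟨i, hi, hiE⟩ := Flat.exists_hyp_of_lt (hsupp hEF (by omega))
  obtain ⟨j, hj, hjF⟩ := Flat.exists_hyp_of_lt (hsupp hFD (by omega))
  have hei : 𝒜.form i e ≠ 0 := by
    rw [← sign_ne_zero, he i]
    exact fun h => hiE ((E.sgn_eq_zero_iff i).1 h)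
  have hfj : 𝒜.form j f ≠ 0 := by
    rw [← sign_ne_zero, hf j]
    exact fun h => hjF ((F.sgn_eq_zero_iff j).1 h)
  -- α and β are the coordinates of f' along e and f modulo |D|: f_i kills F but not E, and f_j
  -- kills D but not F.
  obtain ⟨α, hα⟩ : ∃ α, α = 𝒜.form i f' / 𝒜.form i e := ⟨_, rfl⟩
  have hy : f' - α • e ∈ F.support.carrier := by
    refine Flat.mem_of_form_eq_zero (Face.support_mono hEF) hF hi hiE
      (E.support.carrier.sub_mem (Face.support_mono hEF' (Face.mem_support_of_mem hf'))
        (E.support.carrier.smul_mem _ (Face.mem_support_of_mem he))) ?_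
    rw [map_sub, map_smul, smul_eq_mul, hα]
    field_simp
    ring
  obtain ⟨β, hβ⟩ : ∃ β, β = 𝒜.form j (f' - α • e) / 𝒜.form j f := ⟨_, rfl⟩
  have hz : f' - α • e - β • f ∈ D.support.carrier := by
    refine Flat.mem_of_form_eq_zero (Face.support_mono hFD)
      (by change D.codim = F.codim + 1; omega) hj hjF
      (F.support.carrier.sub_mem hy (F.support.carrier.smul_mem _ (Face.mem_support_of_mem hf))) ?_
    rw [map_sub (𝒜.form j) _ (β • f), map_smul, smul_eq_mul, hβ]
    field_simp
    ring
  have haf : a f' e = β * a f e := by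
    have := haZ _ hz e
    simp only [map_sub, map_smul, LinearMap.sub_apply, LinearMap.smul_apply, smul_eq_mul, ha] at this
    linarith
  have hβpos : 0 < β := by
    rw [haf, sign_mul] at hs hne
    rw [← sign_eq_one_iff]
    revert hs hne
    generalize SignType.sign β = s
    generalize SignType.sign (a f e) = t
    revert s t
    decide
  have hform : ∀ l, D.sgn l = 0 → 𝒜.form l f' = α * 𝒜.form l e + β * 𝒜.form l f := by
    intro l hl
    have h0 : 𝒜.form l (f' - α • e - β • f) = 0 := (D.sgn_eq_zero_iff l).1 hl hz
    simp only [map_sub, map_smul, smul_eq_mul] at h0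
    linarith
  have hα0 : 0 ≤ α := by
    have h1 := Face.form_mul_form_nonneg hEF' he hf' i
    rw [hα, ← mul_div_mul_right _ _ hei]
    exact div_nonneg h1 (mul_self_nonneg _)
  rcases hα0.eq_or_lt with h0 | hpos
  · refine Face.ext (funext fun l => ?_)
    by_cases hl : D.sgn l = 0
    · rw [← hf l, ← hf' l, hform l hl, ← h0, zero_mul, zero_add, sign_mul, sign_pos hβpos, one_mul]
    · rw [← (hFD l).resolve_left hl, ← (hFD' l).resolve_left hl]
  -- For α > 0 the point f' would lie in the open sector, so that F' = E, against the codimensions.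
  · exfalso
    have hEeq : E = F' := by
      refine Face.ext (funext fun l => ?_)
      rcases hEF' l with h1 | h1
      · by_contra hEl
        rw [h1] at hEl
        by_cases hl : D.sgn l = 0
        · have h2 := hform l hl
          rw [sign_eq_zero_iff.1 ((hf' l).trans h1)] at h2
          have h3 := Face.form_mul_form_nonneg hEF he hf l
          have h4 : 𝒜.form l e ≠ 0 := by
            rwa [← sign_ne_zero, he l]
          have h5 : 0 = α * (𝒜.form l e * 𝒜.form l e) + β * (𝒜.form l f * 𝒜.form l e) := by
            rw [← zero_mul (𝒜.form l e), h2]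
            ring
          have := mul_pos hpos (mul_self_pos.2 h4)
          have := mul_nonneg hβpos.le h3
          linarith
        · exact hl (((hFD' l).resolve_left hl).trans h1)
      · exact h1.symm
    rw [hEeq] at hF'
    omega

/-- The other bounding ray of the sector E in the plane |E|/|D| is reached from -f by moving along e
until the closure of E is met. -/
theorem Face.exists_incidence_eq_neg [Finite ι] (o : 𝒜.Coorientation) {E F D : 𝒜.Face}
    (hD : D.codim = E.codim + 2) (hEF : E ≤ F) (hFD : F ≤ D) (hF : F.codim = E.codim + 1) :
    ∃ F' : 𝒜.Face, E ≤ F' ∧ F' ≤ D ∧ F'.codim = E.codim + 1 ∧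
      incidence o F' D.support * incidence o E F'.support =
        - (incidence o F D.support * incidence o E F.support) := by
  obtain ⟨a, ha, haZ, hinc⟩ := exists_area_form o ⟨E.support, rfl⟩ ⟨D.support, hD⟩
  obtain ⟨e, he⟩ := E.points_nonempty
  obtain ⟨f, hf⟩ := F.points_nonempty
  have hsupp : ∀ {A B : 𝒜.Face}, A ≤ B → A.codim < B.codim → A.support < B.support :=
    fun hAB hc => lt_of_le_of_ne (Face.support_mono hAB) fun he => by
      rw [Face.codim, Face.codim, he] at hc
      exact lt_irrefl _ hc
  obtain ⟨i, hi, hiE⟩ := Flat.exists_hyp_of_lt (hsupp hEF (by omega))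
  obtain ⟨j, hj, hjF⟩ := Flat.exists_hyp_of_lt (hsupp hFD (by omega))
  rw [← Face.sgn_eq_zero_iff] at hi hiE hj hjF
  have hDi : D.sgn i = 0 := by
    rcases hFD i with h | h
    · exact h
    · rw [h, hi]
  have hEj : E.sgn j ≠ 0 := by
    rcases hEF j with h | h
    · exact absurd h hjF
    · rwa [← h]
  -- The maximal ratio α is the least number for which αe - f satisfies the weak inequalities of E
  -- at all hyperplanes through D; at the maximizing index l equality holds.
  obtain ⟨l, ⟨hDl, hEl⟩, hmax⟩ := Set.exists_max_image {l | D.sgn l = 0 ∧ E.sgn l ≠ 0}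
    (fun l => 𝒜.form l f / 𝒜.form l e) (Set.toFinite _) ⟨i, hDi, hiE⟩
  obtain ⟨α, hα⟩ : ∃ α, α = 𝒜.form l f / 𝒜.form l e := ⟨_, rfl⟩
  have hform : ∀ m, E.sgn m ≠ 0 → 𝒜.form m e ≠ 0 := fun m hm => by rwa [← sign_ne_zero, he m]
  have hαpos : 0 < α := by
    refine lt_of_lt_of_le ?_ ((hmax j ⟨hj, hEj⟩).trans_eq hα.symm)
    have h1 := Face.form_mul_form_nonneg hEF he hf j
    have h2 : 𝒜.form j f ≠ 0 := by rwa [← sign_ne_zero, hf j]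
    rw [← mul_div_mul_right _ _ (hform j hEj)]
    exact div_pos (lt_of_le_of_ne h1 (mul_ne_zero h2 (hform j hEj)).symm)
      (mul_self_pos.2 (hform j hEj))
  obtain ⟨p, hp⟩ : ∃ p, p = α • e - f := ⟨_, rfl⟩
  have hpm : ∀ m, 𝒜.form m p = α * 𝒜.form m e - 𝒜.form m f := fun m => by
    rw [hp, map_sub, map_smul, smul_eq_mul]
  have hsgn : ∀ m, D.sgn m = 0 → (D * faceOf p).sgn m = SignType.sign (𝒜.form m p) := by
    intro m hm
    rw [Face.mul_sgn, hm, if_neg (by simp)]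
    rfl
  have hEF' : E ≤ D * faceOf p := by
    intro m
    by_cases hm : D.sgn m = 0
    · rw [hsgn m hm]
      by_cases hEm : E.sgn m = 0
      · left
        have hFm : F.sgn m = 0 := by
          rcases hEF m with h | h
          · exact h
          · rw [h, hEm]
        rw [hpm, sign_eq_zero_iff.1 ((he m).trans hEm), sign_eq_zero_iff.1 ((hf m).trans hFm)]
        simp
      · have h1 : 𝒜.form m p = (α - 𝒜.form m f / 𝒜.form m e) * 𝒜.form m e := by
          have := hform m hEm
          rw [hpm]
          field_simp
        have h2 : 0 ≤ α - 𝒜.form m f / 𝒜.form m e := by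
          have := hmax m ⟨hm, hEm⟩
          simp only [← hα] at this
          linarith
        rw [h1, sign_mul, he m]
        rcases h2.eq_or_lt with h3 | h3
        · left
          rw [← h3, sign_zero, zero_mul]
        · right
          rw [sign_pos h3, one_mul]
    · right
      rw [Face.mul_sgn, if_pos hm]
      exact ((hEF.trans hFD) m).resolve_left hm
  have hFD' : D * faceOf p ≤ D := Face.mul_le _ _
  have hl0 : (D * faceOf p).sgn l = 0 := by
    have := hform l hEl
    rw [hsgn l hDl, hpm, hα, sign_eq_zero_iff]
    field_simp
    ring
  have hi0 : (D * faceOf p).sgn i ≠ 0 := by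
    rw [hsgn i hDi, hpm, sign_eq_zero_iff.1 ((hf i).trans hi), sub_zero, sign_ne_zero]
    exact mul_ne_zero hαpos.ne' (hform i hiE)
  have hlt : E.support < (D * faceOf p).support := by
    refine lt_of_le_of_ne (Face.support_mono hEF') fun h => hEl ?_
    rw [Face.sgn_eq_zero_iff, h, ← Face.sgn_eq_zero_iff, hl0]
  have hlt' : (D * faceOf p).support < D.support := by
    refine lt_of_le_of_ne (Face.support_mono hFD') fun h => hi0 ?_
    rw [Face.sgn_eq_zero_iff, h, ← Face.sgn_eq_zero_iff, hDi]
  -- The new face vanishes at l, unlike E, and does not vanish at i, unlike D, so its codimension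
  -- lies strictly between theirs.
  have hc : (D * faceOf p).codim = E.codim + 1 := by
    have h1 := Flat.codim_lt hlt
    have h2 := Flat.codim_lt hlt'
    change D.support.codim = E.support.codim + 2 at hD
    change (D * faceOf p).support.codim = E.support.codim + 1
    omega
  refine ⟨D * faceOf p, hEF', hFD', hc, ?_⟩
  obtain ⟨f', hf'⟩ := (D * faceOf p).points_nonempty
  rw [hinc F E rfl (Face.support_mono hEF) (Face.support_mono hFD) hF f hf e he,
    hinc (D * faceOf p) E rfl (Face.support_mono hEF') (Face.support_mono hFD') hc f' hf' e he]
  have hps : p ∈ (D * faceOf p).support.carrier := by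
    rw [Face.mem_support_iff]
    intro m hm
    by_cases hDm : D.sgn m = 0
    · rw [hsgn m hDm] at hm
      exact sign_eq_zero_iff.1 hm
    · rw [Face.mul_sgn, if_pos hDm] at hm
      exact absurd hm hDm
  -- f' and p span the same line modulo |D| and have the same nonzero sign at i, so a(f', e) has the
  -- sign of a(p, e) = -a(f, e).
  have hz : 𝒜.form i f' • p - 𝒜.form i p • f' ∈ D.support.carrier := by
    refine Flat.mem_of_form_eq_zero hlt'.le ?_ ((D.sgn_eq_zero_iff i).1 hDi)
      (fun h => hi0 ((Face.sgn_eq_zero_iff _ i).2 h))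
      (Submodule.sub_mem _ (Submodule.smul_mem _ _ hps)
        (Submodule.smul_mem _ _ (Face.mem_support_of_mem hf'))) ?_
    · change D.codim = (D * faceOf p).codim + 1
      omega
    · simp only [map_sub, map_smul, smul_eq_mul]
      ring
  have h1 := haZ _ hz e
  rw [hp] at h1
  simp only [map_sub, map_smul, LinearMap.sub_apply, LinearMap.smul_apply, smul_eq_mul, ha] at h1
  have h2 : 𝒜.form i p * a f' e = 𝒜.form i f' * (-(a f e)) := by
    rw [hp, map_sub, map_smul, smul_eq_mul]
    linarith
  have h3 := congrArg SignType.sign h2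
  rw [sign_mul, sign_mul, hf' i, ← hsgn i hDi, Left.sign_neg] at h3
  revert hi0 h3
  generalize (D * faceOf p).sgn i = s
  generalize SignType.sign (a f' e) = t
  generalize SignType.sign (a f e) = t'
  revert s t t'
  decide

-- Passing to the opposite product is an involution of the intermediate faces, by existence and
-- uniqueness of the other bounding ray, and it cancels the terms in pairs. The sum is empty unless
-- E ≤ D.
open Classical in
theorem Face.sum_incidence_mul_incidence [Finite ι] (o : 𝒜.Coorientation) {E D : 𝒜.Face}
    (hD : D.codim = E.codim + 2) :
    ∑ F : 𝒜.Face with E ≤ F ∧ F ≤ D ∧ F.codim = E.codim + 1,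
      incidence o F D.support * incidence o E F.support = 0 := by
  have hex : ∀ F : 𝒜.Face, ∃ F' : 𝒜.Face, (E ≤ F ∧ F ≤ D ∧ F.codim = E.codim + 1) →
      (E ≤ F' ∧ F' ≤ D ∧ F'.codim = E.codim + 1) ∧
      incidence o F' D.support * incidence o E F'.support =
        - (incidence o F D.support * incidence o E F.support) := by
    intro F
    by_cases h : E ≤ F ∧ F ≤ D ∧ F.codim = E.codim + 1
    · obtain ⟨F', h1, h2, h3, h4⟩ := Face.exists_incidence_eq_neg o hD h.1 h.2.1 h.2.2
      exact ⟨F', fun _ => ⟨⟨h1, h2, h3⟩, h4⟩⟩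
    · exact ⟨F, fun h' => absurd h' h⟩
  choose g hg using hex
  refine Finset.sum_involution (fun F _ => g F) (fun F hF => ?_) (fun F hF h0 he => ?_)
    (fun F hF => ?_) (fun F hF => ?_)
  all_goals
    rw [Finset.mem_filter_univ] at hF
    have h1 := hg F hF
  · rw [h1.2, add_neg_cancel]
  · rw [he] at h1
    exact h0 (by linarith [h1.2])
  · rw [Finset.mem_filter_univ]
    exact h1.1
  · have h2 := hg (g F) h1.1
    refine Face.eq_of_incidence_eq o hD h2.1.1 h2.1.2.1 h2.1.2.2 hF.1 hF.2.1 hF.2.2 ?_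
    rw [h2.2, h1.2, neg_neg]

end Diamond

/-! ### Flags of flats as sequences indexed by ℕ. -/

section FlagSequences

variable {ι W : Type*} [AddCommGroup W] [Module ℝ W] {𝒜 : HypArrangement ι W}

/-- The sequence of flats given by a flag, continued arbitrarily. -/
def LocalFlag.seq {p : ℕ} {X : 𝒜.Flat} (𝒳 : 𝒜.LocalFlag p X) (n : ℕ) : 𝒜.Flat :=
  if h : n < p + 1 then 𝒳.flat ⟨n, h⟩ else X

theorem LocalFlag.seq_coe {p : ℕ} {X : 𝒜.Flat} (𝒳 : 𝒜.LocalFlag p X) (j : Fin (p + 1)) :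
    𝒳.seq j = 𝒳.flat j := dif_pos j.2

theorem LocalFlag.codim_seq {p : ℕ} {X : 𝒜.Flat} (𝒳 : 𝒜.LocalFlag p X) {n : ℕ} (h : n ≤ p) :
    (𝒳.seq n).codim = n := by
  rw [LocalFlag.seq, dif_pos (Nat.lt_succ_of_le h), 𝒳.codim_eq]

theorem LocalFlag.seq_lt {p : ℕ} {X : 𝒜.Flat} (𝒳 : 𝒜.LocalFlag p X) {m n : ℕ} (hmn : m < n)
    (h : n ≤ p) : 𝒳.seq m < 𝒳.seq n := by
  rw [LocalFlag.seq, dif_pos (by omega), LocalFlag.seq, dif_pos (by omega)]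
  exact 𝒳.strictMono hmn

variable [FiniteDimensional ℝ W]

theorem LocalFlag.seq_zero {p : ℕ} {X : 𝒜.Flat} (𝒳 : 𝒜.LocalFlag p X) :
    𝒳.seq 0 = 𝒜.wholeFlat :=
  Flat.eq_wholeFlat_of_codim (𝒳.codim_seq (Nat.zero_le p))

theorem LocalFlag.seq_eq {p : ℕ} {X : 𝒜.Flat} (𝒳 : 𝒜.LocalFlag p X) (hX : X.codim = p) :
    𝒳.seq p = X :=
  Flat.eq_of_le_of_codim (by
    rw [LocalFlag.seq, dif_pos (Nat.lt_succ_self p)]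
    exact 𝒳.le _) (by rw [hX, 𝒳.codim_seq le_rfl])

end FlagSequences

noncomputable instance {ι W : Type*} [Finite ι] [AddCommGroup W] [Module ℝ W]
    (𝒜 : HypArrangement ι W) : Fintype 𝒜.Flat := Fintype.ofFinite _

/-! ### Boundary operators and the flag relations. -/

section Boundary

variable (R : Type*) [CommRing R] {ι W : Type*} [Finite ι] [AddCommGroup W] [Module ℝ W]
  [FiniteDimensional ℝ W] {𝒜 : HypArrangement ι W} (o : 𝒜.Coorientation)

open Classical in
/-- The operator on the face algebra that sends a face `C` with support `Y` to the sum, weighted by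
incidence numbers, of the faces with support `X` whose closure contains `C`, and all other faces
to `0`. -/
noncomputable def boundary (X Y : 𝒜.Flat) : Module.End R (𝒜.FaceAlgebra R) :=
  (MonoidAlgebra.basis 𝒜.Face R).constr R fun C =>
    if C.support = Y then
      ∑ F : 𝒜.Face with F ≤ C ∧ F.support = X, incidence o F Y • MonoidAlgebra.of R 𝒜.Face F
    else 0

open Classical in
theorem boundary_of (X Y : 𝒜.Flat) (C : 𝒜.Face) :
    boundary R o X Y (MonoidAlgebra.of R 𝒜.Face C) = if C.support = Y then
      ∑ F : 𝒜.Face with F ≤ C ∧ F.support = X, incidence o F Y • MonoidAlgebra.of R 𝒜.Face F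
    else 0 :=
  Module.Basis.constr_basis _ R _ C

theorem boundary_of_eq_smul {C G : 𝒜.Face} (h : G.support ≤ C.support)
    (hc : C.support.codim = G.support.codim + 1) :
    boundary R o G.support C.support (MonoidAlgebra.of R 𝒜.Face C) =
      incidence o G C.support • (MonoidAlgebra.of R 𝒜.Face C *
        (MonoidAlgebra.of R 𝒜.Face G - MonoidAlgebra.of R 𝒜.Face G.opp)) := by
  classical
  have hlt := IsContraction.lt (X := ⟨G.support, rfl⟩) (Y := ⟨C.support, hc⟩) h
  have hopp : G.opp.support = G.support := G.support_opp
  have hset : (Finset.univ.filter fun F : 𝒜.Face => F ≤ C ∧ F.support = G.support) =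
      {C * G, C * G.opp} := by
    ext F
    rw [Finset.mem_filter_univ, Finset.mem_insert, Finset.mem_singleton]
    constructor
    · rintro ⟨h1, h2⟩
      exact Face.eq_mul_or_eq_mul_opp h1 (by rw [Face.codim, Face.codim, h2, hc]) h2.symm
    · rintro (rfl | rfl)
      · exact ⟨Face.mul_le _ _, Face.support_mul _ _ h⟩
      · exact ⟨Face.mul_le _ _, (Face.support_mul _ _ (hopp ▸ h)).trans hopp⟩
  rw [boundary_of, if_pos rfl, hset, Finset.sum_pair (Face.mul_ne_mul_opp hlt),
    incidence_mul o h hc, incidence_mul o (hopp ▸ h) (hopp ▸ hc), incidence_opp o h hc, mul_sub,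
    map_mul, map_mul, neg_smul, smul_sub, sub_eq_add_neg]

-- The coefficient of E in the image of D collects all paths from D through some F to E; summing
-- over the flats Y removes the restriction on |F|, and what remains is the sum over the diamond
-- between E and D.
open Classical in
theorem sum_boundary_mul_boundary {X Z : 𝒜.Flat} (hc : Z.codim = X.codim + 2) :
    ∑ Y : 𝒜.Flat with X < Y ∧ Y < Z, boundary R o X Y * boundary R o Y Z = 0 := by
  refine (MonoidAlgebra.basis 𝒜.Face R).ext fun D => ?_
  change (∑ Y : 𝒜.Flat with X < Y ∧ Y < Z, boundary R o X Y * boundary R o Y Z)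
    (MonoidAlgebra.of R 𝒜.Face D) = 0
  by_cases hD : D.support = Z
  swap
  · rw [LinearMap.sum_apply]
    refine Finset.sum_eq_zero fun Y _ => ?_
    rw [Module.End.mul_apply, boundary_of, if_neg hD, map_zero]
  have h1 : ∀ Y, (boundary R o X Y * boundary R o Y Z) (MonoidAlgebra.of R 𝒜.Face D) =
      ∑ F : 𝒜.Face, if F.support = Y then (∑ E : 𝒜.Face,
        if F ≤ D ∧ E ≤ F ∧ E.support = X then
          (incidence o F Z * incidence o E F.support) • MonoidAlgebra.of R 𝒜.Face E else 0)
      else 0 := by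
    intro Y
    rw [Module.End.mul_apply, boundary_of, if_pos hD, map_sum, Finset.sum_filter]
    refine Finset.sum_congr rfl fun F _ => ?_
    by_cases hFY : F.support = Y
    · by_cases hFD : F ≤ D
      · rw [if_pos ⟨hFD, hFY⟩, if_pos hFY, map_zsmul, boundary_of, if_pos hFY, Finset.sum_filter,
          Finset.smul_sum]
        refine Finset.sum_congr rfl fun E _ => ?_
        by_cases hE : E ≤ F ∧ E.support = X
        · rw [if_pos hE, if_pos ⟨hFD, hE⟩, smul_smul, hFY]
        · rw [if_neg hE, if_neg fun h => hE h.2, smul_zero]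
      · simp [hFD]
    · simp [hFY]
  rw [LinearMap.sum_apply, Finset.sum_congr rfl fun Y _ => h1 Y, Finset.sum_comm]
  simp only [Finset.sum_ite_eq, Finset.mem_filter_univ]
  rw [← Finset.sum_filter, Finset.sum_comm]
  refine Finset.sum_eq_zero fun E _ => ?_
  by_cases hE : E.support = X
  · rw [← Finset.sum_filter, Finset.filter_filter, ← Finset.sum_smul]
    have h2 : (Finset.univ.filter fun F : 𝒜.Face => (X < F.support ∧ F.support < Z) ∧
        F ≤ D ∧ E ≤ F ∧ E.support = X) =
        Finset.univ.filter fun F : 𝒜.Face => E ≤ F ∧ F ≤ D ∧ F.codim = E.codim + 1 := by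
      ext F
      rw [Finset.mem_filter_univ, Finset.mem_filter_univ, Face.codim, Face.codim, hE]
      constructor
      · rintro ⟨⟨hXF, hFZ⟩, hFD, hEF, -⟩
        have := Flat.codim_lt hXF
        have := Flat.codim_lt hFZ
        exact ⟨hEF, hFD, by omega⟩
      · rintro ⟨hEF, hFD, hF⟩
        refine ⟨⟨lt_of_le_of_ne (hE ▸ Face.support_mono hEF) fun h => ?_,
          lt_of_le_of_ne (hD ▸ Face.support_mono hFD) fun h => ?_⟩, hFD, hEF, rfl⟩
        · rw [← h] at hF
          omega
        · rw [h] at hF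
          omega
    rw [h2, ← hD, Face.sum_incidence_mul_incidence o (by
      rw [Face.codim, Face.codim, hD, hE, hc]), zero_smul]
  · exact Finset.sum_eq_zero fun F _ => if_neg fun h => hE h.2.2

/-- The composition of the boundary operators along a sequence of flats. -/
noncomputable def flagBoundary (x : ℕ → 𝒜.Flat) : ℕ → Module.End R (𝒜.FaceAlgebra R)
  | 0 => 1
  | n + 1 => flagBoundary x n * boundary R o (x n) (x (n + 1))

theorem flagBoundary_congr {x y : ℕ → 𝒜.Flat} {n : ℕ} (h : ∀ j ≤ n, x j = y j) :
    flagBoundary R o x n = flagBoundary R o y n := by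
  induction n with
  | zero => rfl
  | succ n ih =>
    rw [flagBoundary, flagBoundary, ih fun j hj => h j (by omega), h n (by omega),
      h (n + 1) le_rfl]

-- The flat at position m + 1 enters only the two adjacent factors; the factors on both sides of
-- them come out of the sum.
open Classical in
theorem sum_flagBoundary_update (x : ℕ → 𝒜.Flat) (m t : ℕ)
    (hc : (x (m + 2)).codim = (x m).codim + 2) :
    ∑ Y : 𝒜.Flat with x m < Y ∧ Y < x (m + 2),
      flagBoundary R o (Function.update x (m + 1) Y) (m + 2 + t) = 0 := by
  induction t with
  | zero =>
    have h1 : ∀ Y, flagBoundary R o (Function.update x (m + 1) Y) (m + 2) =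
        flagBoundary R o x m * (boundary R o (x m) Y * boundary R o Y (x (m + 2))) := by
      intro Y
      rw [flagBoundary, flagBoundary, Function.update_self,
        Function.update_of_ne (show m ≠ m + 1 by omega),
        Function.update_of_ne (show m + 2 ≠ m + 1 by omega), mul_assoc,
        flagBoundary_congr R o (y := x) fun j hj => Function.update_of_ne (by omega) _ _]
    simp only [add_zero, h1]
    rw [← Finset.mul_sum, sum_boundary_mul_boundary R o hc, mul_zero]
  | succ t ih =>
    have h1 : ∀ Y, flagBoundary R o (Function.update x (m + 1) Y) (m + 2 + (t + 1)) =
        flagBoundary R o (Function.update x (m + 1) Y) (m + 2 + t) *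
          boundary R o (x (m + 2 + t)) (x (m + 2 + t + 1)) := by
      intro Y
      rw [← add_assoc, flagBoundary,
        Function.update_of_ne (show m + 2 + t ≠ m + 1 by omega),
        Function.update_of_ne (show m + 2 + t + 1 ≠ m + 1 by omega)]
    simp only [h1]
    rw [← Finset.sum_mul, ih, zero_mul]

-- Flags that agree with 𝒳 away from i correspond to the flats strictly between the neighbours of
-- position i; the codimension of such a flat is automatically i.
open Classical in
theorem sum_flagBoundary_eq_zero {p : ℕ} {X : 𝒜.Flat} (𝒳 : 𝒜.LocalFlag p X) {i : Fin (p + 1)}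
    (h0 : 0 < (i : ℕ)) (hp : (i : ℕ) < p) :
    ∑ 𝒴 : 𝒜.LocalFlag p X with ∀ j, j ≠ i → 𝒴.flat j = 𝒳.flat j,
      flagBoundary R o 𝒴.seq p = 0 := by
  obtain ⟨m, hm⟩ : ∃ m, (i : ℕ) = m + 1 := ⟨i - 1, by omega⟩
  obtain ⟨t, ht⟩ : ∃ t, p = m + 2 + t := ⟨p - (m + 2), by omega⟩
  have hoff : ∀ 𝒴 : 𝒜.LocalFlag p X, (∀ j, j ≠ i → 𝒴.flat j = 𝒳.flat j) →
      ∀ n, n ≠ m + 1 → 𝒴.seq n = 𝒳.seq n := by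
    intro 𝒴 h n hn
    by_cases h' : n < p + 1
    · rw [LocalFlag.seq, LocalFlag.seq, dif_pos h', dif_pos h']
      exact h _ fun he => hn (by rw [← hm, ← he])
    · rw [LocalFlag.seq, LocalFlag.seq, dif_neg h', dif_neg h']
  have hcod : (𝒳.seq (m + 2)).codim = (𝒳.seq m).codim + 2 := by
    rw [𝒳.codim_seq (by omega), 𝒳.codim_seq (by omega)]
  rw [← sum_flagBoundary_update R o 𝒳.seq m t hcod, ← ht]
  refine Finset.sum_bij (fun 𝒴 _ => 𝒴.flat i) (fun 𝒴 h𝒴 => ?_) (fun 𝒴 h𝒴 𝒴' h𝒴' he => ?_)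
    (fun Y hY => ?_) (fun 𝒴 h𝒴 => ?_)
  · rw [Finset.mem_filter_univ] at h𝒴
    rw [Finset.mem_filter_univ, ← hoff 𝒴 h𝒴 m (by omega), ← hoff 𝒴 h𝒴 (m + 2) (by omega),
      ← 𝒴.seq_coe, hm]
    exact ⟨𝒴.seq_lt (by omega) (by omega), 𝒴.seq_lt (by omega) (by omega)⟩
  · rw [Finset.mem_filter_univ] at h𝒴 h𝒴'
    refine LocalFlag.ext (funext fun j => ?_)
    by_cases hj : j = i
    · rw [hj, he]
    · rw [h𝒴 j hj, h𝒴' j hj]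
  · rw [Finset.mem_filter_univ] at hY
    have hc1 := Flat.codim_lt hY.1
    have hc2 := Flat.codim_lt hY.2
    rw [𝒳.codim_seq (by omega)] at hc1 hc2
    refine ⟨⟨Function.update 𝒳.flat i Y, Fin.strictMono_iff_lt_succ.2 fun j => ?_, fun j => ?_,
      fun j => ?_⟩, ?_, ?_⟩
    · by_cases h1 : j.castSucc = i
      · have h2 : j.succ ≠ i := fun h => by
          have := congrArg Fin.val (h1.trans h.symm)
          simp at this
        have h3 : (j : ℕ) = m + 1 := by rw [← hm, ← h1]; rfl
        rw [h1, Function.update_self, Function.update_of_ne h2, ← 𝒳.seq_coe, Fin.val_succ, h3]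
        exact hY.2
      · rw [Function.update_of_ne h1]
        by_cases h2 : j.succ = i
        · have h3 : (j : ℕ) + 1 = m + 1 := by rw [← hm, ← h2]; rfl
          rw [h2, Function.update_self, ← 𝒳.seq_coe, Fin.val_castSucc,
            show (j : ℕ) = m by omega]
          exact hY.1
        · rw [Function.update_of_ne h2]
          exact 𝒳.strictMono Fin.castSucc_lt_succ
    · by_cases h1 : j = i
      · rw [h1, Function.update_self]
        omega
      · rw [Function.update_of_ne h1, 𝒳.codim_eq]
    · by_cases h1 : j = i
      · rw [h1, Function.update_self]
        refine hY.2.le.trans ?_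
        rw [LocalFlag.seq]
        split_ifs
        · exact 𝒳.le _
        · exact le_rfl
      · rw [Function.update_of_ne h1]
        exact 𝒳.le _
    · rw [Finset.mem_filter_univ]
      exact fun j hj => Function.update_of_ne hj _ _
    · exact Function.update_self _ _ _
  · rw [Finset.mem_filter_univ] at h𝒴
    congr 1
    funext n
    by_cases hn : n = m + 1
    · rw [hn, Function.update_self, ← 𝒴.seq_coe, hm]
    · rw [Function.update_of_ne hn, hoff 𝒴 h𝒴 n hn]

end Boundary

/-! ### Products of differences of opposite faces. -/

section DiffProd

variable (R : Type*) [CommRing R] {ι W : Type*} [Finite ι] [AddCommGroup W] [Module ℝ W]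
  {𝒜 : HypArrangement ι W}

theorem of_mul_diffProd_succ (K : 𝒜.Face) {p : ℕ} (G : Fin (p + 1) → 𝒜.Face) :
    MonoidAlgebra.of R 𝒜.Face K * diffProd R 𝒜 (p + 1) G =
      MonoidAlgebra.of R 𝒜.Face (K * G (Fin.last p)) * diffProd R 𝒜 p (fun j => G j.castSucc) -
      MonoidAlgebra.of R 𝒜.Face (K * (G (Fin.last p)).opp) *
        diffProd R 𝒜 p (fun j => G j.castSucc) := by
  rw [diffProd, ← mul_assoc, mul_sub, sub_mul, map_mul, map_mul]

/-- The product expands into chambers, which absorb any face on their right. Hence letting it act on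
an arbitrary chamber recovers it as an element of V(𝒜). -/
theorem of_mul_diffProd_mul_of {x : ℕ → 𝒜.Flat} {p : ℕ} (h0 : x 0 = 𝒜.wholeFlat)
    (hx : ∀ j < p, x j ≤ x (j + 1)) {G : Fin p → 𝒜.Face}
    (hG : ∀ j, (G j).support = x j) {K : 𝒜.Face} (hK : K.support = x p) {C : 𝒜.Face}
    (hC : C.support = 𝒜.wholeFlat) :
    MonoidAlgebra.of R 𝒜.Face K * diffProd R 𝒜 p G * MonoidAlgebra.of R 𝒜.Face C =
      MonoidAlgebra.of R 𝒜.Face K * diffProd R 𝒜 p G := by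
  induction p generalizing K with
  | zero =>
    rw [diffProd, mul_one, ← map_mul, Face.mul_eq_left (by rw [hK, hC, h0])]
  | succ p ih =>
    have hGl : (G (Fin.last p)).support = x p := hG (Fin.last p)
    have hGo : (G (Fin.last p)).opp.support = x p := (Face.support_opp _).trans hGl
    have hle : x p ≤ K.support := by
      rw [hK]
      exact hx p (Nat.lt_succ_self p)
    have ih' := fun {K : 𝒜.Face} => ih (fun j hj => hx j (by omega))
      (G := fun j => G j.castSucc) (fun j => hG j.castSucc) (K := K)
    rw [of_mul_diffProd_succ, sub_mul, ih' ((Face.support_mul _ _ (hGl.le.trans hle)).trans hGl),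
      ih' ((Face.support_mul _ _ (hGo.le.trans hle)).trans hGo)]

variable [FiniteDimensional ℝ W] (o : 𝒜.Coorientation)

/-- The faces G_j need only have the right supports. So the induction hypothesis applies with the
same G, and the same sign, to both terms of the boundary of K. -/
theorem flagBoundary_of {x : ℕ → 𝒜.Flat} {p : ℕ} (hx : ∀ j < p, x j ≤ x (j + 1))
    (hc : ∀ j ≤ p, (x j).codim = j) {G : Fin p → 𝒜.Face} (hG : ∀ j, (G j).support = x j)
    {K : 𝒜.Face} (hK : K.support = x p) :
    flagBoundary R o x p (MonoidAlgebra.of R 𝒜.Face K) =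
      (∏ j, incidence o (G j) (x (j + 1))) •
        (MonoidAlgebra.of R 𝒜.Face K * diffProd R 𝒜 p G) := by
  induction p generalizing K with
  | zero => simp [flagBoundary, diffProd]
  | succ p ih =>
    have hGl : (G (Fin.last p)).support = x p := hG (Fin.last p)
    have hGo : (G (Fin.last p)).opp.support = x p := (Face.support_opp _).trans hGl
    have hle : (G (Fin.last p)).support ≤ K.support := by
      rw [hGl, hK]
      exact hx p (Nat.lt_succ_self p)
    have ih' := fun {K : 𝒜.Face} => ih (fun j hj => hx j (by omega)) (fun j hj => hc j (by omega))
      (G := fun j => G j.castSucc) (fun j => hG j.castSucc) (K := K)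
    have hb := boundary_of_eq_smul R o hle (by rw [hGl, hK, hc _ le_rfl, hc _ (Nat.le_succ p)])
    rw [hGl, hK] at hb
    rw [flagBoundary, Module.End.mul_apply, hb,
      map_zsmul, mul_sub, map_sub, ← map_mul, ← map_mul, ih' ((Face.support_mul _ _ hle).trans hGl),
      ih' ((Face.support_mul _ _ ((hGo.trans hGl.symm).le.trans hle)).trans hGo), ← smul_sub,
      ← of_mul_diffProd_succ, smul_smul, Fin.prod_univ_castSucc, mul_comm]
    rfl

/-- Multiplying by the G_j from the top down keeps the support strictly below x_j until it equals
the support of the next face. That face and its opposite are then both absorbed, and their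
difference gives zero. This must occur, since nothing lies below x_0 = W. -/
theorem of_mul_diffProd_eq_zero {x : ℕ → 𝒜.Flat} {p : ℕ} (h0 : x 0 = 𝒜.wholeFlat)
    (hx : ∀ j < p, x j ≤ x (j + 1)) (hc : ∀ j ≤ p, (x j).codim = j) {G : Fin p → 𝒜.Face}
    (hG : ∀ j, (G j).support = x j) {K : 𝒜.Face} (hK : K.support < x p) :
    MonoidAlgebra.of R 𝒜.Face K * diffProd R 𝒜 p G = 0 := by
  induction p generalizing K with
  | zero =>
    rw [h0] at hK
    exact absurd (wholeFlat_le _) hK.not_ge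
  | succ p ih =>
    have hGl : (G (Fin.last p)).support = x p := hG (Fin.last p)
    have hGo : (G (Fin.last p)).opp.support = x p := (Face.support_opp _).trans hGl
    have ih' := fun {K : 𝒜.Face} => ih (fun j hj => hx j (by omega)) (fun j hj => hc j (by omega))
      (G := fun j => G j.castSucc) (fun j => hG j.castSucc) (K := K)
    have hle : ∀ H : 𝒜.Face, H.support = x p → (K * H).support ≤ x p := fun H hH =>
      hH ▸ ((Face.le_support_mul_iff K H _).1 le_rfl).2
    rw [of_mul_diffProd_succ]
    by_cases hKx : x p ≤ K.support
    · have hKp : K.support = x p := by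
        have h1 := Flat.codim_lt hK
        rw [hc _ le_rfl] at h1
        exact (Flat.eq_of_le_of_codim hKx (by rw [hc _ (Nat.le_succ p)]; omega)).symm
      rw [Face.mul_eq_left (hKp.trans hGl.symm).le, Face.mul_eq_left (hKp.trans hGo.symm).le,
        sub_self]
    · have hlt : ∀ H : 𝒜.Face, H.support = x p → (K * H).support < x p := fun H hH =>
        lt_of_le_of_ne (hle H hH) fun he =>
          hKx ((Face.le_support_mul_iff K H (x p)).1 he.ge).1
      rw [ih' (hlt _ hGl), ih' (hlt _ hGo), sub_zero]

end DiffProd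

/-! ### Differences of opposite faces raise the filtration W^p. -/

section Filtration

open MvPolynomial

variable (R : Type*) [CommRing R] {ι W : Type*} [AddCommGroup W] [Module ℝ W]
  {𝒜 : HypArrangement ι W}

open Classical in
/-- The substitution that describes how composition with the action of a face changes the functions
`x_H`. -/
noncomputable def faceSubst (F : 𝒜.Face) (i : ι) : MvPolynomial ι R :=
  if F.sgn i = 0 then X i else C (if F.sgn i = 1 then 1 else 0)

theorem totalDegree_faceSubst_le (F : 𝒜.Face) (i : ι) : (faceSubst R F i).totalDegree ≤ 1 := by
  rw [faceSubst]
  split_ifs with h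
  · exact (totalDegree_monomial_le _ _).trans (by simp)
  all_goals simp

theorem totalDegree_prod_faceSubst_lt (F : 𝒜.Face) (m : ι →₀ ℕ) {i : ι} (hi : i ∈ m.support)
    (hF : F.sgn i ≠ 0) : (∏ j ∈ m.support, faceSubst R F j ^ m j).totalDegree <
      m.sum fun _ n => n := by
  refine (totalDegree_finsetProd _ _).trans_lt (Finset.sum_lt_sum (fun j _ => ?_) ⟨i, hi, ?_⟩)
  · refine (totalDegree_pow _ _).trans ?_
    exact (Nat.mul_le_mul_left _ (totalDegree_faceSubst_le R F j)).trans (by simp)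
  · refine (totalDegree_pow _ _).trans_lt ?_
    rw [faceSubst, if_neg hF, totalDegree_C, mul_zero]
    exact Nat.pos_of_ne_zero (Finsupp.mem_support_iff.1 hi)

/-- If F vanishes at all variables of the monomial, both substitutions fix it and cancel; otherwise
some variable becomes constant in both, and the degree drops. The first alternative covers the
constant monomial, whose degree cannot drop. -/
theorem prod_faceSubst_sub_eq_zero_or (F : 𝒜.Face) (m : ι →₀ ℕ) :
    (∏ j ∈ m.support, faceSubst R F j ^ m j) - ∏ j ∈ m.support, faceSubst R F.opp j ^ m j = 0 ∨
    ((∏ j ∈ m.support, faceSubst R F j ^ m j) -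
      ∏ j ∈ m.support, faceSubst R F.opp j ^ m j).totalDegree < m.sum fun _ n => n := by
  by_cases h : ∃ i ∈ m.support, F.sgn i ≠ 0
  · obtain ⟨i, hi, hF⟩ := h
    right
    refine (totalDegree_sub _ _).trans_lt (max_lt (totalDegree_prod_faceSubst_lt R F m hi hF)
      (totalDegree_prod_faceSubst_lt R F.opp m hi ?_))
    simpa [Face.opp] using hF
  · left
    push Not at h
    refine sub_eq_zero.2 (Finset.prod_congr rfl fun j hj => ?_)
    simp [faceSubst, Face.opp, h j hj]

theorem aeval_faceSubst_sub (F : 𝒜.Face) (q : MvPolynomial ι R) :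
    aeval (faceSubst R F) q - aeval (faceSubst R F.opp) q =
      ∑ m ∈ q.support, q.coeff m • ((∏ j ∈ m.support, faceSubst R F j ^ m j) -
        ∏ j ∈ m.support, faceSubst R F.opp j ^ m j) := by
  rw [aeval_def, aeval_def, eval₂_eq, eval₂_eq, ← Finset.sum_sub_distrib]
  refine Finset.sum_congr rfl fun m _ => ?_
  rw [smul_sub, Algebra.smul_def, Algebra.smul_def]

theorem aeval_faceSubst_sub_eq_zero (F : 𝒜.Face) {q : MvPolynomial ι R} (hq : q.totalDegree = 0) :
    aeval (faceSubst R F) q - aeval (faceSubst R F.opp) q = 0 := by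
  rw [totalDegree_eq_zero_iff_eq_C.1 hq, algHom_C, algHom_C, sub_self]

theorem totalDegree_aeval_faceSubst_sub_le (F : 𝒜.Face) {q : MvPolynomial ι R} {d : ℕ}
    (hq : q.totalDegree ≤ d + 1) :
    (aeval (faceSubst R F) q - aeval (faceSubst R F.opp) q).totalDegree ≤ d := by
  rw [aeval_faceSubst_sub]
  refine totalDegree_finsetSum_le fun m hm => (totalDegree_smul_le _ _).trans ?_
  rcases prod_faceSubst_sub_eq_zero_or R F m with h | h
  · rw [h, totalDegree_zero]
    exact Nat.zero_le d
  · have := (le_totalDegree hm).trans hq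
    omega

variable [Finite ι]

theorem apply_faceAct_of {f : Module.Dual R (𝒜.VA R)} {q : MvPolynomial ι R}
    (hf : ∀ C, f (V.of R 𝒜 C) = eval (heaviside R 𝒜 C) q) (F : 𝒜.Face)
    (C : 𝒜.Chamber 𝒜.wholeFlat) :
    f (faceAct R 𝒜 𝒜.wholeFlat F (V.of R 𝒜 C)) =
      eval (heaviside R 𝒜 C) (aeval (faceSubst R F) q) := by
  rw [faceAct_of, faceActOn, dif_pos (wholeFlat_le _), hf, ← coe_aeval_eq_eval,
    ← coe_aeval_eq_eval]
  change _ = ((aeval (heaviside R 𝒜 C)).comp (aeval (faceSubst R F))) q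
  rw [comp_aeval]
  change aeval _ q = _
  congr 2
  funext i
  by_cases h : F.sgn i = 0
  · simp [faceSubst, h, heaviside, Face.mul_sgn]
  · simp only [faceSubst, h, heaviside, Face.mul_sgn]
    by_cases h1 : F.sgn i = 1 <;> simp [h, h1]

theorem of_smul (X : 𝒜.Flat) (F : 𝒜.Face) (v : 𝒜.V R X) :
    MonoidAlgebra.of R 𝒜.Face F • v = faceAct R 𝒜 X F v := by
  rw [algebra_smul_def, algAct, MonoidAlgebra.lift_of]

/-- The action is moved to the functional: the transpose of F minus its opposite lowers polynomial
degree by at least one. -/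
theorem sub_opp_smul_mem_filtW (F : 𝒜.Face) {p : ℕ} {v : 𝒜.VA R} (hv : v ∈ filtW R 𝒜 p) :
    (MonoidAlgebra.of R 𝒜.Face F - MonoidAlgebra.of R 𝒜.Face F.opp) • v ∈ filtW R 𝒜 (p + 1) := by
  rintro d hd f ⟨q, hq, hf⟩
  obtain rfl : d = p := by omega
  set g : Module.Dual R (𝒜.VA R) :=
    f ∘ₗ (faceAct R 𝒜 𝒜.wholeFlat F - faceAct R 𝒜 𝒜.wholeFlat F.opp) with hg
  have hgC : ∀ C, g (V.of R 𝒜 C) = eval (heaviside R 𝒜 C)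
      (aeval (faceSubst R F) q - aeval (faceSubst R F.opp) q) := by
    intro C
    rw [hg, LinearMap.comp_apply, LinearMap.sub_apply, map_sub, apply_faceAct_of R hf,
      apply_faceAct_of R hf, map_sub]
  have hgv : f ((MonoidAlgebra.of R 𝒜.Face F - MonoidAlgebra.of R 𝒜.Face F.opp) • v) = g v := by
    rw [sub_smul, of_smul, of_smul]
    rfl
  rw [hgv]
  -- For d = 0 membership of v in W^0 says nothing; instead the functional itself is zero, as
  -- constants are killed.
  cases d with
  | zero =>
    have : g = 0 := (V.basis R 𝒜 𝒜.wholeFlat).ext fun C => by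
      rw [V.basis_apply, hgC, aeval_faceSubst_sub_eq_zero R F (Nat.le_zero.1 hq), map_zero]
      rfl
    rw [this]
    rfl
  | succ d =>
    exact hv d rfl g ⟨_, totalDegree_aeval_faceSubst_sub_le R F hq, hgC⟩

theorem diffProd_smul_mem_filtW {p : ℕ} (G : Fin p → 𝒜.Face) (v : 𝒜.VA R) :
    diffProd R 𝒜 p G • v ∈ filtW R 𝒜 p := by
  induction p with
  | zero => exact fun d hd => absurd hd (by omega)
  | succ p ih =>
    rw [diffProd, mul_smul]
    exact sub_opp_smul_mem_filtW R _ (ih _)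

end Filtration

/-! ### Induction over linear combinations of chambers. -/

section ChamberInduction

variable {R : Type*} [CommRing R] {ι W : Type*} [AddCommGroup W] [Module ℝ W]
  {𝒜 : HypArrangement ι W}

theorem V.induction_on {X : 𝒜.Flat} {P : 𝒜.V R X → Prop} (v : 𝒜.V R X) (zero : P 0)
    (add : ∀ v w, P v → P w → P (v + w)) (smul_of : ∀ (r : R) C, P (r • V.of R 𝒜 C)) : P v := by
  induction v using Finsupp.induction_linear with
  | zero => exact zero
  | add v w hv hw => exact add v w hv hw
  | single C r =>
    have : r • V.of R 𝒜 C = Finsupp.single C r :=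
      (Finsupp.smul_single r C 1).trans (by rw [smul_eq_mul, mul_one])
    exact this ▸ smul_of r C

end ChamberInduction

/-! ### The map φ_p: construction, linearity and uniqueness. -/

section FlagMap

variable (R : Type*) [CommRing R] {ι W : Type*} [Finite ι] [AddCommGroup W] [Module ℝ W]
  (𝒜 : HypArrangement ι W)

theorem chamberIncl_of (C : 𝒜.Chamber 𝒜.wholeFlat) :
    chamberIncl R 𝒜 (V.of R 𝒜 C) = MonoidAlgebra.of R 𝒜.Face C.1 :=
  (V.basis R 𝒜 𝒜.wholeFlat).constr_basis R _ C

theorem chamberIncl_injective : Function.Injective (chamberIncl R 𝒜) := by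
  have h : LinearIndependent R fun C : 𝒜.Chamber 𝒜.wholeFlat => MonoidAlgebra.of R 𝒜.Face C.1 :=
    (MonoidAlgebra.basis 𝒜.Face R).linearIndependent.comp (fun C : 𝒜.Chamber _ => C.1)
      Subtype.val_injective
  exact (V.basis R 𝒜 𝒜.wholeFlat).injective_constr_of_linearIndependent h

theorem single_smul (X : 𝒜.Flat) (F : 𝒜.Face) (r : R) (v : 𝒜.V R X) :
    (MonoidAlgebra.single F r : 𝒜.FaceAlgebra R) • v = r • faceAct R 𝒜 X F v := by
  rw [algebra_smul_def, algAct, MonoidAlgebra.lift_single, LinearMap.smul_apply]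

theorem chamberIncl_faceAct (F : 𝒜.Face) (v : 𝒜.VA R) :
    chamberIncl R 𝒜 (faceAct R 𝒜 𝒜.wholeFlat F v) =
      MonoidAlgebra.of R 𝒜.Face F * chamberIncl R 𝒜 v := by
  suffices h : chamberIncl R 𝒜 ∘ₗ faceAct R 𝒜 𝒜.wholeFlat F =
      LinearMap.mulLeft R (MonoidAlgebra.of R 𝒜.Face F) ∘ₗ chamberIncl R 𝒜 from
    LinearMap.congr_fun h v
  refine (V.basis R 𝒜 𝒜.wholeFlat).ext fun C => ?_
  rw [LinearMap.comp_apply, LinearMap.comp_apply, V.basis_apply, faceAct_of, faceActOn,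
    dif_pos (wholeFlat_le _), chamberIncl_of, chamberIncl_of, LinearMap.mulLeft_apply, map_mul]

theorem chamberIncl_smul (a : 𝒜.FaceAlgebra R) (v : 𝒜.VA R) :
    chamberIncl R 𝒜 (a • v) = a * chamberIncl R 𝒜 v := by
  induction a using MonoidAlgebra.induction_linear with
  | zero => rw [zero_smul, map_zero, zero_mul]
  | add a b ha hb => rw [add_smul, map_add, ha, hb, add_mul]
  | single F r =>
    rw [single_smul, map_smul, chamberIncl_faceAct, ← smul_mul_assoc, MonoidAlgebra.of_apply,
      MonoidAlgebra.smul_single, smul_eq_mul, mul_one]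

/-- The inclusion of `V(𝒜^X)` in the face algebra as an `R`-module. -/
noncomputable def faceIncl (X : 𝒜.Flat) : 𝒜.V R X →ₗ[R] 𝒜.FaceAlgebra R :=
  (V.basis R 𝒜 X).constr R fun C => MonoidAlgebra.of R 𝒜.Face C.1

theorem faceIncl_of {X : 𝒜.Flat} (C : 𝒜.Chamber X) :
    faceIncl R 𝒜 X (V.of R 𝒜 C) = MonoidAlgebra.of R 𝒜.Face C.1 :=
  (V.basis R 𝒜 X).constr_basis R _ C

/-- A chamber of `𝒜`. -/
noncomputable def someChamber : 𝒜.Chamber 𝒜.wholeFlat :=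
  ⟨𝒜.wholeFlat.exists_face.choose, 𝒜.wholeFlat.exists_face.choose_spec⟩

variable {R 𝒜} in
/-- `Fl_p(𝒜_X) ⊗ V(𝒜^X)` is additively generated by tensors of flags with elements of `V(𝒜^X)`. -/
theorem FlV.induction_on {p : ℕ} {X : 𝒜.Flat} {P : 𝒜.FlV R p X → Prop} (m : 𝒜.FlV R p X) (zero : P 0)
    (add : ∀ m n, P m → P n → P (m + n))
    (tmul : ∀ (𝒳 : 𝒜.LocalFlag p X) (v : 𝒜.V R X), P (FlV.tmul R 𝒜 (Fl.of R 𝒜 𝒳) v)) : P m := by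
  refine TensorProduct.induction_on m zero (fun ξ v => ?_) add
  obtain ⟨x, rfl⟩ := Submodule.mkQ_surjective _ ξ
  induction x using Finsupp.induction_linear with
  | zero =>
    rw [map_zero, TensorProduct.zero_tmul]
    exact zero
  | add x y hx hy =>
    rw [map_add, TensorProduct.add_tmul]
    exact add _ _ hx hy
  | single 𝒳 r =>
    have : (flagRelations R 𝒜 p X).mkQ (Finsupp.single 𝒳 r) ⊗ₜ[R] v =
        FlV.tmul R 𝒜 (Fl.of R 𝒜 𝒳) (r • v) := by
      rw [FlV.tmul, Fl.of, ← TensorProduct.smul_tmul, ← map_smul, Finsupp.smul_single, smul_eq_mul,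
        mul_one]
    rw [this]
    exact tmul _ _

theorem LocalFlag.exists_faces {𝒜 : HypArrangement ι W} {p : ℕ} {X : 𝒜.Flat}
    (𝒳 : 𝒜.LocalFlag p X) :
    ∃ G : Fin p → 𝒜.Face, ∀ j, (G j).support = 𝒳.seq j := by
  choose G hG using fun j : Fin p => (𝒳.seq j).exists_face
  exact ⟨G, hG⟩

variable [FiniteDimensional ℝ W] {𝒜} (o : 𝒜.Coorientation) {p : ℕ} {X : 𝒜.Flat}

/-- The map `V(𝒜^X) → V(𝒜)` that belongs to a flag. -/
noncomputable def flagMap (𝒳 : 𝒜.LocalFlag p X) : 𝒜.V R X →ₗ[R] 𝒜.VA R :=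
  (algAct R 𝒜 𝒜.wholeFlat).toLinearMap.flip (V.of R 𝒜 𝒜.someChamber) ∘ₗ
    flagBoundary R o 𝒳.seq p ∘ₗ faceIncl R 𝒜 X

theorem flagMap_apply (𝒳 : 𝒜.LocalFlag p X) (v : 𝒜.V R X) :
    flagMap R o 𝒳 v =
      flagBoundary R o 𝒳.seq p (faceIncl R 𝒜 X v) • V.of R 𝒜 𝒜.someChamber := rfl

variable {R} in
theorem LocalFlag.flagBoundary_of (𝒳 : 𝒜.LocalFlag p X) (hX : X.codim = p)
    {G : Fin p → 𝒜.Face} (hG : ∀ j, (G j).support = 𝒳.seq j) (C : 𝒜.Chamber X) :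
    flagBoundary R o 𝒳.seq p (MonoidAlgebra.of R 𝒜.Face C.1) =
      (∏ j, incidence o (G j) (𝒳.seq (j + 1))) •
        (MonoidAlgebra.of R 𝒜.Face C.1 * diffProd R 𝒜 p G) :=
  HypArrangement.flagBoundary_of R o (fun _ hj => (𝒳.seq_lt (Nat.lt_succ_self _) hj).le)
    (fun _ hj => 𝒳.codim_seq hj) hG (C.2.trans (𝒳.seq_eq hX).symm)

theorem chamberIncl_flagMap_of (𝒳 : 𝒜.LocalFlag p X) (hX : X.codim = p)
    {G : Fin p → 𝒜.Face} (hG : ∀ j, (G j).support = 𝒳.seq j) (C : 𝒜.Chamber X) :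
    chamberIncl R 𝒜 (flagMap R o 𝒳 (V.of R 𝒜 C)) =
      (∏ j, incidence o (G j) (𝒳.seq (j + 1))) •
        (MonoidAlgebra.of R 𝒜.Face C.1 * diffProd R 𝒜 p G) := by
  rw [flagMap_apply, faceIncl_of, 𝒳.flagBoundary_of o hX hG, chamberIncl_smul, chamberIncl_of,
    smul_mul_assoc, of_mul_diffProd_mul_of R 𝒳.seq_zero
      (fun _ hj => (𝒳.seq_lt (Nat.lt_succ_self _) hj).le) hG (C.2.trans (𝒳.seq_eq hX).symm)
      𝒜.someChamber.2]

theorem flagMap_mem_filtW (𝒳 : 𝒜.LocalFlag p X) (hX : X.codim = p) (v : 𝒜.V R X) :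
    flagMap R o 𝒳 v ∈ filtW R 𝒜 p := by
  obtain ⟨G, hG⟩ := 𝒳.exists_faces
  induction v using V.induction_on with
  | zero =>
    rw [map_zero]
    exact zero_mem _
  | add v w hv hw =>
    rw [map_add]
    exact add_mem hv hw
  | smul_of r C =>
    -- W^p is a submodule over the face algebra, so the scalar is rewritten as a multiple of the
    -- identity face.
    have : r • flagMap R o 𝒳 (V.of R 𝒜 C) =
        (MonoidAlgebra.single 1 r : 𝒜.FaceAlgebra R) • flagMap R o 𝒳 (V.of R 𝒜 C) := by
      rw [single_smul, map_one]
      rfl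
    rw [map_smul, this, flagMap_apply, faceIncl_of, 𝒳.flagBoundary_of o hX hG, smul_assoc, mul_smul]
    exact Submodule.smul_mem _ _
      (zsmul_mem (Submodule.smul_mem _ _ (diffProd_smul_mem_filtW R _ _)) _)

/-- With the faces G fixed, the sign does not depend on C, so replacing C by FC is left
multiplication by F. If F kills C, the support of FC is strictly below X and the product is zero. -/
theorem flagMap_faceAct (𝒳 : 𝒜.LocalFlag p X) (hX : X.codim = p) (F : 𝒜.Face) (v : 𝒜.V R X) :
    flagMap R o 𝒳 (faceAct R 𝒜 X F v) = faceAct R 𝒜 𝒜.wholeFlat F (flagMap R o 𝒳 v) := by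
  obtain ⟨G, hG⟩ := 𝒳.exists_faces
  suffices h : flagMap R o 𝒳 ∘ₗ faceAct R 𝒜 X F =
      faceAct R 𝒜 𝒜.wholeFlat F ∘ₗ flagMap R o 𝒳 from LinearMap.congr_fun h v
  refine (V.basis R 𝒜 X).ext fun C => chamberIncl_injective R 𝒜 ?_
  rw [LinearMap.comp_apply, LinearMap.comp_apply, V.basis_apply, faceAct_of,
    chamberIncl_faceAct, chamberIncl_flagMap_of R o 𝒳 hX hG, faceActOn]
  split_ifs with h
  · rw [chamberIncl_flagMap_of R o 𝒳 hX hG, map_mul, mul_smul_comm, mul_assoc]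
  · rw [map_zero, map_zero, mul_smul_comm, ← mul_assoc, ← map_mul,
      of_mul_diffProd_eq_zero R 𝒳.seq_zero
        (fun _ hj => (𝒳.seq_lt (Nat.lt_succ_self _) hj).le) (fun _ hj => 𝒳.codim_seq hj) hG,
      smul_zero]
    rw [𝒳.seq_eq hX]
    refine lt_of_le_of_ne ?_ fun he => h ?_
    · exact ((Face.le_support_mul_iff F C.1 _).1 le_rfl).2.trans_eq C.2
    · exact ((Face.le_support_mul_iff F C.1 X).1 he.ge).1

variable (p X) in
theorem flagRelations_le_ker :
    flagRelations R 𝒜 p X ≤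
      LinearMap.ker (Finsupp.linearCombination R (flagMap R o (p := p) (X := X))) := by
  refine Submodule.span_le.2 ?_
  rintro _ ⟨𝒳, i, h0, hp, rfl⟩
  rw [SetLike.mem_coe, LinearMap.mem_ker, flagRelation, map_sum]
  simp only [Finsupp.linearCombination_single, one_smul]
  refine LinearMap.ext fun v => ?_
  rw [LinearMap.sum_apply]
  simp only [flagMap_apply]
  rw [← Finset.sum_smul, ← LinearMap.sum_apply, sum_flagBoundary_eq_zero R o 𝒳 h0 hp]
  simp

/-- The map `Fl_p(𝒜_X) ⊗ V(𝒜^X) → V(𝒜)` of `R`-modules. -/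
noncomputable def tensorMap (p : ℕ) (X : 𝒜.Flat) : 𝒜.FlV R p X →ₗ[R] 𝒜.VA R :=
  TensorProduct.lift ((flagRelations R 𝒜 p X).liftQ
    (Finsupp.linearCombination R (flagMap R o (p := p) (X := X)))
    (flagRelations_le_ker R o p X))

theorem tensorMap_tmul_of (𝒳 : 𝒜.LocalFlag p X) (v : 𝒜.V R X) :
    tensorMap R o p X (FlV.tmul R 𝒜 (Fl.of R 𝒜 𝒳) v) = flagMap R o 𝒳 v := by
  refine (TensorProduct.lift.tmul _ _).trans ?_
  rw [Fl.of, Submodule.mkQ_apply, Submodule.liftQ_apply, Finsupp.linearCombination_single, one_smul]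

theorem tensorMap_mem_filtW (hX : X.codim = p) (m : 𝒜.FlV R p X) :
    tensorMap R o p X m ∈ filtW R 𝒜 p := by
  induction m using FlV.induction_on with
  | zero =>
    rw [map_zero]
    exact zero_mem _
  | add m n hm hn =>
    rw [map_add]
    exact add_mem hm hn
  | tmul 𝒳 v =>
    rw [tensorMap_tmul_of]
    exact flagMap_mem_filtW R o 𝒳 hX v

theorem tensorMap_smul (hX : X.codim = p) (a : 𝒜.FaceAlgebra R) (m : 𝒜.FlV R p X) :
    tensorMap R o p X (a • m) = a • tensorMap R o p X m := by
  induction m using FlV.induction_on with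
  | zero => rw [smul_zero, map_zero, smul_zero]
  | add m n hm hn => rw [smul_add, map_add, hm, hn, map_add, smul_add]
  | tmul 𝒳 v =>
    rw [FlV.smul_tmul, tensorMap_tmul_of, tensorMap_tmul_of]
    induction a using MonoidAlgebra.induction_linear with
    | zero => rw [zero_smul, zero_smul, map_zero]
    | add a b ha hb => rw [add_smul, add_smul, map_add, ha, hb]
    | single F r => rw [single_smul, single_smul, map_smul, flagMap_faceAct R o 𝒳 hX]

/-- The map `Fl_p(𝒜_X) ⊗ V(𝒜^X) → W^p V(𝒜)` of modules over the face algebra. -/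
noncomputable def tensorMapFiltW (X : 𝒜.L p) :
    𝒜.FlV R p X.1 →ₗ[𝒜.FaceAlgebra R] 𝒜.filtW R p where
  toFun m := ⟨tensorMap R o p X.1 m, tensorMap_mem_filtW R o X.2 m⟩
  map_add' m n := Subtype.ext (map_add _ m n)
  map_smul' a m := Subtype.ext (tensorMap_smul R o X.2 a m)

open Classical in
variable (p) in
/-- The map `⨁_X Fl_p(𝒜_X) ⊗ V(𝒜^X) → W^p V(𝒜)` of modules over the face algebra. -/
noncomputable def sourceMap : 𝒜.Source R p →ₗ[𝒜.FaceAlgebra R] 𝒜.filtW R p :=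
  DirectSum.toModule (𝒜.FaceAlgebra R) (𝒜.L p) (𝒜.filtW R p) fun X => tensorMapFiltW R o X

open Classical in
theorem sourceMap_of (X : 𝒜.L p) (m : 𝒜.FlV R p X.1) :
    (sourceMap R o p (DirectSum.of (fun X : 𝒜.L p => 𝒜.FlV R p X.1) X m) : 𝒜.VA R) =
      tensorMap R o p X.1 m :=
  by
  rw [sourceMap, ← DirectSum.lof_eq_of (𝒜.FaceAlgebra R), DirectSum.toModule_lof]
  rfl

theorem chamberIncl_sourceMap_tmul (X : 𝒜.L p) (𝒳 : 𝒜.LocalFlag p X.1) (C : 𝒜.Chamber X.1)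
    (𝔉 : 𝒜.FaceFlag p) (h : 𝔉.LiesOver 𝒳 C) :
    chamberIncl R 𝒜 (sourceMap R o p (Source.tmul R 𝒜 X 𝒳 C)) = 𝔉.sign o • 𝔉.cochain R 𝒜 := by
  rw [Source.tmul, sourceMap_of, tensorMap_tmul_of,
    chamberIncl_flagMap_of R o 𝒳 X.2 (G := fun j => 𝔉.face j.castSucc)
      (fun j => (h.1 j.castSucc).trans (𝒳.seq_coe j.castSucc).symm),
    FaceFlag.cochain, h.2, FaceFlag.sign]
  congr 1
  refine Finset.prod_congr rfl fun j _ => ?_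
  refine Eq.trans ?_ (eps_eq_incidence o
    (F := ⟨𝔉.face j.castSucc, 𝔉.codim_eq j.castSucc⟩) (G := ⟨𝔉.face j.succ, 𝔉.codim_eq j.succ⟩)
    (Face.support_mono (𝔉.strictMono Fin.castSucc_lt_succ).le)).symm
  rw [h.1 j.succ, ← 𝒳.seq_coe]
  rfl

/-- The flag is built downwards from C: for any G with support X_m, the face F_{m+1} G has support
X_m and F_{m+1} in its closure. -/
theorem exists_liesOver (X : 𝒜.L p) (𝒳 : 𝒜.LocalFlag p X.1) (C : 𝒜.Chamber X.1) :
    ∃ 𝔉 : 𝒜.FaceFlag p, 𝔉.LiesOver 𝒳 C := by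
  -- Here n counts the steps down from position p; the entries of F outside the range from p - n to
  -- p are irrelevant.
  have key : ∀ n ≤ p, ∃ F : ℕ → 𝒜.Face, F p = C.1 ∧
      (∀ j, p - n ≤ j → j ≤ p → (F j).support = 𝒳.seq j) ∧
      ∀ j, p - n ≤ j → j < p → F j < F (j + 1) := by
    intro n
    induction n with
    | zero =>
      intro _
      refine ⟨fun _ => C.1, rfl, fun j h1 h2 => ?_, fun j h1 h2 => absurd h1 (by omega)⟩
      obtain rfl : j = p := by omega
      exact C.2.trans (𝒳.seq_eq X.2).symm
    | succ n ih =>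
      intro hn
      obtain ⟨F, hFp, hFs, hFlt⟩ := ih (by omega)
      obtain ⟨m, hm⟩ : ∃ m, p - n = m + 1 := ⟨p - n - 1, by omega⟩
      obtain ⟨G, hG⟩ := (𝒳.seq m).exists_face
      have hlt : 𝒳.seq m < 𝒳.seq (m + 1) := 𝒳.seq_lt (Nat.lt_succ_self m) (by omega)
      have hs : (F (m + 1) * G).support = 𝒳.seq m :=
        (Face.support_mul _ _ (by
          rw [hG, hFs _ (by omega) (by omega)]
          exact hlt.le)).trans hG
      refine ⟨Function.update F m (F (m + 1) * G), ?_, fun j h1 h2 => ?_, fun j h1 h2 => ?_⟩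
      · rw [Function.update_of_ne (by omega), hFp]
      · by_cases hj : j = m
        · rw [hj, Function.update_self, hs]
        · rw [Function.update_of_ne hj, hFs j (by omega) h2]
      · by_cases hj : j = m
        · rw [hj, Function.update_self, Function.update_of_ne (by omega)]
          refine lt_of_le_of_ne (Face.mul_le _ _) fun he => hlt.ne ?_
          rw [← hs, he, hFs _ (by omega) (by omega)]
        · rw [Function.update_of_ne hj, Function.update_of_ne (by omega)]
          exact hFlt j (by omega) h2
  obtain ⟨F, hFp, hFs, hFlt⟩ := key p le_rfl
  have hs : ∀ j : Fin (p + 1), (F j).support = 𝒳.flat j := fun j =>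
    (hFs j (by omega) (by omega)).trans (𝒳.seq_coe j)
  refine ⟨⟨fun j => F j, Fin.strictMono_iff_lt_succ.2 fun j => hFlt j (by omega) j.2, fun j => ?_⟩,
    hs, hFp⟩
  rw [Face.codim, hs, 𝒳.codim_eq]

theorem eq_sourceMap (ψ : 𝒜.Source R p →ₗ[R] 𝒜.VA R)
    (h : ∀ (X : 𝒜.L p) (𝒳 : 𝒜.LocalFlag p X.1) (C : 𝒜.Chamber X.1),
      ψ (Source.tmul R 𝒜 X 𝒳 C) = sourceMap R o p (Source.tmul R 𝒜 X 𝒳 C)) (m : 𝒜.Source R p) :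
    ψ m = sourceMap R o p m := by
  classical
  induction m using DirectSum.induction_on with
  | zero => rw [map_zero, map_zero, Submodule.coe_zero]
  | add m n hm hn => rw [map_add, map_add, Submodule.coe_add, hm, hn]
  | of X m =>
    rw [sourceMap_of]
    induction m using FlV.induction_on with
    | zero => rw [map_zero, map_zero, map_zero]
    | add m n hm hn => rw [map_add, map_add, map_add, hm, hn]
    | tmul 𝒳 v =>
      suffices hl : ψ ∘ₗ DirectSum.lof R (𝒜.L p) (fun X : 𝒜.L p => 𝒜.FlV R p X.1) X ∘ₗ
          TensorProduct.mk R _ _ (Fl.of R 𝒜 𝒳) = flagMap R o 𝒳 by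
        rw [tensorMap_tmul_of, ← hl]
        rfl
      refine (V.basis R 𝒜 X.1).ext fun C => ?_
      have := h X 𝒳 C
      rw [Source.tmul, sourceMap_of, tensorMap_tmul_of] at this
      rw [V.basis_apply, ← this]
      refine congrArg ψ ?_
      rfl

end FlagMap

end HypArrangement

theorem lemma3p3 {R : Type*} [CommRing R] {ι W : Type*} [Finite ι] [AddCommGroup W] [Module ℝ W]
    [FiniteDimensional ℝ W] (𝒜 : HypArrangement ι W) (o : 𝒜.Coorientation) (p : ℕ) :
    (∀ (X : 𝒜.L p) (𝒳 : 𝒜.LocalFlag p X.1) (C : 𝒜.Chamber X.1),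
      ∃ 𝔉 : 𝒜.FaceFlag p, 𝔉.LiesOver 𝒳 C) ∧
    ∃ φ : 𝒜.Source R p →ₗ[𝒜.FaceAlgebra R] 𝒜.filtW R p,
      (∀ (X : 𝒜.L p) (𝒳 : 𝒜.LocalFlag p X.1) (C : 𝒜.Chamber X.1) (𝔉 : 𝒜.FaceFlag p),
        𝔉.LiesOver 𝒳 C →
          HypArrangement.chamberIncl R 𝒜 (φ (HypArrangement.Source.tmul R 𝒜 X 𝒳 C)) =
            𝔉.sign o • 𝔉.cochain R 𝒜) ∧
      ∀ ψ : 𝒜.Source R p →ₗ[R] 𝒜.VA R,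
        (∀ (X : 𝒜.L p) (𝒳 : 𝒜.LocalFlag p X.1) (C : 𝒜.Chamber X.1) (𝔉 : 𝒜.FaceFlag p),
          𝔉.LiesOver 𝒳 C →
            HypArrangement.chamberIncl R 𝒜 (ψ (HypArrangement.Source.tmul R 𝒜 X 𝒳 C)) =
              𝔉.sign o • 𝔉.cochain R 𝒜) →
        ∀ m, ψ m = φ m := by
  refine ⟨HypArrangement.exists_liesOver, HypArrangement.sourceMap R o p,
    HypArrangement.chamberIncl_sourceMap_tmul R o, fun ψ hψ m => ?_⟩
  refine HypArrangement.eq_sourceMap R o ψ (fun X 𝒳 C => ?_) m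
  -- The condition on ψ speaks about flags of faces; it fixes ψ on a generator only because such a
  -- flag exists over it.
  obtain ⟨𝔉, h𝔉⟩ := HypArrangement.exists_liesOver X 𝒳 C
  refine HypArrangement.chamberIncl_injective R 𝒜 ?_
  rw [hψ X 𝒳 C 𝔉 h𝔉, HypArrangement.chamberIncl_sourceMap_tmul R o X 𝒳 C 𝔉 h𝔉]
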